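/- Let $d\ge 1$. **Tiles.** A *tile* in $\mathbb R^d$ is a bounded Lebesgue measurable set of positive measure (volume) whose boundary has measure zero. A *tessellation* of $U\subset\mathbb R^d$ is a collection of tiles with pairwise disjoint interiors and union $U$. A *patch* is a tessellation of a bounded set; its *support* is the union of its tiles. A *tiling* is a tessellation of $\mathbb R^d$ in which only finitely many tiles meet any given ball. For a collection $\mathcal P$ of tiles, $\partial\mathcal P$ denotes the union of the boundaries of its tiles. **Schemes.** A (normalized) *multiscale substitution scheme* $\sigma$ in $\mathbb R^d$ consists of finitely many tiles $T_1,\dots,T_n$ of unit volume (prototiles) and, for every $i$, a finite tessellation $\varrho_\sigma(T_i)$ of $T_i$ by translates of sets $\alpha T_j$ ("tiles of type $j$") with $0<\alpha<1$. For $t\ge 0$, $F_t(T_i)$ is the patch supported on $e^tT_i$ that is obtained from $e^tT_i$ by repeatedly substituting, according to $\varrho_\sigma$, every tile of volume greater than $1$, until all tiles have volume at most $1$. The *generating patches* of $\sigma$ are the patches $F_t(T_i)$, $1\le i\le n$, $t\ge0$. The scheme is *irreducible* if for all $i,j$ there is $t>0$ such that $F_t(T_i)$ contains a tile of type $j$.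 It is *incommensurable* if there are $i,j$ and times $t_1,t_2>0$ with $t_1\notin\mathbb Q t_2$ such that $F_{t_1}(T_i)$ contains a tile of type $i$ and unit volume and $F_{t_2}(T_j)$ contains a tile of type $j$ and unit volume. **Tiling space.** On the space $\mathscr C(\mathbb R^d)$ of closed subsets of $\mathbb R^d$ let $$D(A_1,A_2)=\inf\Big(\big\{r>0:\ A_1\cap B(0,1/r)\subset A_2^{+r},\ A_2\cap B(0,1/r)\subset A_1^{+r}\big\}\cup\{1\}\Big),$$ where $A^{+r}$ is the open $r$-neighbourhood of $A$. A patch $\mathcal Q$ is a *limit* of patches $\mathcal Q_k$ if $D(\partial\mathcal Q_k,\partial\mathcal Q)\to0$ and the volume of the symmetric difference of the supports of $\mathcal Q_k$ and $\mathcal Q$ tends to $0$. The *multiscale tiling space* $\mathbb X_\sigma^F$ consists of all tilings $\mathcal T$ of $\mathbb R^d$ such that every sub-patch of $\mathcal T$ is a limit of translates of sub-patches of generating patches of $\sigma$. A tiling $\mathcal T$ is identified with the closed set $\partial\mathcal T$, and $\mathbb X_\sigma^F\subset\mathscr C(\mathbb R^d)$ carries the topology induced by $D$. The group $\mathbb R^d$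 acts on $\mathbb X_\sigma^F$ by translations. **Theorem.** Let $\sigma$ be an irreducible incommensurable multiscale substitution scheme in $\mathbb R^d$. Then $\mathbb X_\sigma^F$ is non-empty and the dynamical system $(\mathbb X_\sigma^F,\mathbb R^d)$ is minimal, that is, the orbit $\{\mathcal T+v: v\in\mathbb R^d\}$ of every $\mathcal T\in\mathbb X_\sigma^F$ is dense in $\mathbb X_\sigma^F$. -/

import Mathlib

open Set Filter Topology MeasureTheory
open scoped Pointwise

namespace MultiscaleTiling

/-- Euclidean space `ℝ^d` with its Euclidean distance. -/
abbrev Space (d : ℕ) := EuclideanSpace ℝ (Fin d)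

/-! ### Tiles, patches and tilings -/

/-- A tile: a bounded Lebesgue measurable set of positive volume with boundary of measure zero. -/
def IsTile {d : ℕ} (T : Set (Space d)) : Prop :=
  Bornology.IsBounded T ∧ NullMeasurableSet T volume ∧ 0 < volume T ∧ volume (frontier T) = 0

/-- A tessellation of `U`: a collection of tiles with pairwise disjoint interiors and union `U`. -/
def IsTessellation {d : ℕ} (P : Set (Set (Space d))) (U : Set (Space d)) : Prop :=
  (∀ T ∈ P, IsTile T) ∧ P.Pairwise (fun S T => Disjoint (interior S) (interior T)) ∧ ⋃₀ P = U

/-- A tiling: a tessellation of the whole space. Local finiteness makes the union of the boundaries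
of the tiles a closed set. -/
def IsTiling {d : ℕ} (P : Set (Set (Space d))) : Prop :=
  IsTessellation P univ ∧ ∀ r : ℝ, {T ∈ P | (T ∩ Metric.ball 0 r).Nonempty}.Finite

/-- The union of the boundaries of the tiles of a collection. -/
def bdry {d : ℕ} (P : Set (Set (Space d))) : Set (Space d) := ⋃ T ∈ P, frontier T

/-- The collection of all translates by `v` of the tiles of a collection. -/
def translate {d : ℕ} (v : Space d) (P : Set (Set (Space d))) : Set (Set (Space d)) :=
  (fun T => v +ᵥ T) '' P

/-! ### The Chabauty--Fell metric and the translation action -/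

/-- The radii `r > 0` such that inside `B(0, 1/r)` each set is in the open `r`-neighbourhood
of the other. -/
def cfRadii {d : ℕ} (A B : Set (Space d)) : Set ℝ :=
  {r | 0 < r ∧ A ∩ Metric.ball 0 (1 / r) ⊆ Metric.thickening r B ∧
    B ∩ Metric.ball 0 (1 / r) ⊆ Metric.thickening r A}

/-- The Chabauty--Fell distance `D`. -/
noncomputable def cfDist {d : ℕ} (A B : Set (Space d)) : ℝ := sInf (cfRadii A B ∪ {1})

theorem cfDist_set_bddBelow {d : ℕ} (A B : Set (Space d)) : BddBelow (cfRadii A B ∪ {1}) :=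
  ⟨0, by
    rintro r (hr | hr)
    · exact hr.1.le
    · rw [mem_singleton_iff.1 hr]; exact zero_le_one⟩

theorem cfDist_nonneg {d : ℕ} (A B : Set (Space d)) : 0 ≤ cfDist A B := by
  refine le_csInf ⟨1, Or.inr rfl⟩ ?_
  rintro r (hr | hr)
  · exact hr.1.le
  · rw [mem_singleton_iff.1 hr]; exact zero_le_one

theorem cfDist_le_one {d : ℕ} (A B : Set (Space d)) : cfDist A B ≤ 1 :=
  csInf_le (cfDist_set_bddBelow A B) (Or.inr rfl)

theorem cfDist_le {d : ℕ} {A B : Set (Space d)} {r : ℝ} (hr : r ∈ cfRadii A B) :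
    cfDist A B ≤ r :=
  csInf_le (cfDist_set_bddBelow A B) (Or.inl hr)

theorem exists_radius {d : ℕ} {A B : Set (Space d)} {r : ℝ} (h : cfDist A B < r) (hr : r ≤ 1) :
    ∃ s ∈ cfRadii A B, s < r := by
  obtain ⟨s, hs | hs, hsr⟩ := exists_lt_of_csInf_lt (⟨1, Or.inr rfl⟩ : (cfRadii A B ∪ {1}).Nonempty) h
  · exact ⟨s, hs, hsr⟩
  · rw [mem_singleton_iff.1 hs] at hsr
    linarith

theorem cfDist_comm {d : ℕ} (A B : Set (Space d)) : cfDist A B = cfDist B A := by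
  have h : cfRadii A B = cfRadii B A := by
    ext r
    exact ⟨fun h => ⟨h.1, h.2.2, h.2.1⟩, fun h => ⟨h.1, h.2.2, h.2.1⟩⟩
  rw [cfDist, cfDist, h]

theorem cfDist_self {d : ℕ} (A : Set (Space d)) : cfDist A A = 0 := by
  refine le_antisymm (le_of_forall_pos_le_add fun e he => ?_) (cfDist_nonneg A A)
  rw [zero_add]
  exact cfDist_le ⟨he, inter_subset_left.trans (Metric.self_subset_thickening he A),
    inter_subset_left.trans (Metric.self_subset_thickening he A)⟩

theorem ball_step {r s : ℝ} (hr : 0 < r) (hs : 0 < s) (h : r + s ≤ 1) :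
    1 / (r + s) + r ≤ 1 / s := by
  rw [div_add' _ _ _ (by positivity), div_le_div_iff₀ (by positivity) hs]
  nlinarith [mul_pos hr hs, mul_pos hr hr, mul_pos hs hs, mul_nonneg hr.le (sub_nonneg.2 h)]

theorem half_triangle {d : ℕ} {A B C : Set (Space d)} {r s : ℝ} (hr : 0 < r) (hs : 0 < s)
    (h : r + s ≤ 1) (h1 : A ∩ Metric.ball 0 (1 / r) ⊆ Metric.thickening r B)
    (h2 : B ∩ Metric.ball 0 (1 / s) ⊆ Metric.thickening s C) :
    A ∩ Metric.ball 0 (1 / (r + s)) ⊆ Metric.thickening (r + s) C := by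
  rintro x ⟨hxA, hx⟩
  have hx' : x ∈ Metric.ball (0 : Space d) (1 / r) :=
    Metric.ball_subset_ball (one_div_le_one_div_of_le hr (by linarith)) hx
  obtain ⟨y, hyB, hxy⟩ := Metric.mem_thickening_iff.1 (h1 ⟨hxA, hx'⟩)
  have hy : y ∈ Metric.ball (0 : Space d) (1 / s) := by
    rw [Metric.mem_ball] at hx ⊢
    have := dist_triangle_left y 0 x
    linarith [ball_step hr hs h]
  obtain ⟨z, hzC, hyz⟩ := Metric.mem_thickening_iff.1 (h2 ⟨hyB, hy⟩)
  refine Metric.mem_thickening_iff.2 ⟨z, hzC, ?_⟩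
  linarith [dist_triangle x y z]

theorem cfDist_triangle {d : ℕ} (A B C : Set (Space d)) :
    cfDist A C ≤ cfDist A B + cfDist B C := by
  by_cases h : 1 ≤ cfDist A B + cfDist B C
  · exact (cfDist_le_one A C).trans h
  push Not at h
  refine le_of_forall_pos_le_add fun e he => ?_
  set f : ℝ := min (e / 2) ((1 - (cfDist A B + cfDist B C)) / 2) with hf
  have hf0 : 0 < f := lt_min (by linarith) (by linarith)
  have hfe : f ≤ e / 2 := min_le_left _ _
  have hf1 : f ≤ (1 - (cfDist A B + cfDist B C)) / 2 := min_le_right _ _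
  have hAB := cfDist_nonneg A B
  have hBC := cfDist_nonneg B C
  obtain ⟨r, hr, hr'⟩ := exists_radius (A := A) (B := B) (r := cfDist A B + f)
    (by linarith) (by linarith)
  obtain ⟨s, hs, hs'⟩ := exists_radius (A := B) (B := C) (r := cfDist B C + f)
    (by linarith) (by linarith)
  have hrs : r + s ≤ 1 := by linarith
  have hmem : r + s ∈ cfRadii A C := by
    refine ⟨add_pos hr.1 hs.1, half_triangle hr.1 hs.1 hrs hr.2.1 hs.2.1, ?_⟩
    rw [add_comm r s]
    exact half_triangle hs.1 hr.1 (by linarith) hs.2.2 hr.2.2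
  linarith [cfDist_le hmem]

theorem subset_closure_of_cfDist_eq_zero {d : ℕ} {A B : Set (Space d)} (h : cfDist A B = 0) :
    A ⊆ closure B := by
  intro x hx
  refine Metric.mem_closure_iff.2 fun e he => ?_
  set f : ℝ := min (min e (1 / (‖x‖ + 1))) 1 with hf
  have hn : 0 < ‖x‖ + 1 := by positivity
  have hf0 : 0 < f := lt_min (lt_min he (by positivity)) one_pos
  obtain ⟨r, hr, hrf⟩ := exists_radius (A := A) (B := B) (r := f) (by linarith) (min_le_right _ _)
  have h1 : r ≤ 1 / (‖x‖ + 1) :=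
    hrf.le.trans ((min_le_left _ _).trans (min_le_right _ _))
  have h2 : r < e := hrf.trans_le ((min_le_left _ _).trans (min_le_left _ _))
  have h3 : ‖x‖ + 1 ≤ 1 / r := (le_one_div hr.1 hn).1 h1
  have hxb : x ∈ Metric.ball (0 : Space d) (1 / r) := by
    rw [mem_ball_zero_iff]; linarith
  obtain ⟨y, hy, hxy⟩ := Metric.mem_thickening_iff.1 (hr.2.1 ⟨hx, hxb⟩)
  exact ⟨y, hy, hxy.trans h2⟩

/-- The space of closed subsets of `ℝ^d`. -/
@[ext]
structure ClosedSubset (d : ℕ) where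
  carrier : Set (Space d)
  isClosed : IsClosed carrier

/-- The metric `D` on the space of closed subsets. -/
noncomputable instance (d : ℕ) : MetricSpace (ClosedSubset d) where
  dist A B := cfDist A.carrier B.carrier
  dist_self A := cfDist_self A.carrier
  dist_comm A B := cfDist_comm A.carrier B.carrier
  dist_triangle A B C := cfDist_triangle A.carrier B.carrier C.carrier
  eq_of_dist_eq_zero := by
    intro A B h
    have hAB : A.carrier ⊆ B.carrier := by
      simpa [B.isClosed.closure_eq] using subset_closure_of_cfDist_eq_zero h
    have hBA : B.carrier ⊆ A.carrier := by
      simpa [A.isClosed.closure_eq] using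
        subset_closure_of_cfDist_eq_zero ((cfDist_comm _ _).trans h)
    exact ClosedSubset.ext (hAB.antisymm hBA)

/-- `ℝ^d` acts on closed sets by translations. -/
instance (d : ℕ) : AddAction (Space d) (ClosedSubset d) where
  vadd v A := ⟨v +ᵥ A.carrier, A.isClosed.vadd v⟩
  zero_vadd A := ClosedSubset.ext (zero_vadd _ A.carrier)
  add_vadd u v A := ClosedSubset.ext (add_vadd u v A.carrier)

theorem carrier_vadd {d : ℕ} (v : Space d) (A : ClosedSubset d) :
    (v +ᵥ A).carrier = v +ᵥ A.carrier := rfl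

theorem half_vadd {d : ℕ} {A B : Set (Space d)} {r s : ℝ} (v : Space d) (hs : s ≤ r)
    (hv : 1 / r + ‖v‖ ≤ 1 / s) (h : A ∩ Metric.ball 0 (1 / s) ⊆ Metric.thickening s B) :
    (v +ᵥ A) ∩ Metric.ball 0 (1 / r) ⊆ Metric.thickening r (v +ᵥ B) := by
  rintro _ ⟨⟨x, hx, rfl⟩, hxb⟩
  simp only [vadd_eq_add, mem_ball_zero_iff] at hxb
  have hxs : x ∈ Metric.ball (0 : Space d) (1 / s) := by
    rw [mem_ball_zero_iff]
    have h1 : ‖x‖ ≤ ‖v + x‖ + ‖v‖ := by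
      simpa using norm_sub_le (v + x) v
    linarith
  obtain ⟨y, hy, hxy⟩ := Metric.mem_thickening_iff.1 (h ⟨hx, hxs⟩)
  exact Metric.mem_thickening_iff.2
    ⟨v +ᵥ y, vadd_mem_vadd_set hy, by simpa using hxy.trans_le hs⟩

theorem tendsto_cfDist_vadd {d : ℕ} {A : ℕ → Set (Space d)} {B : Set (Space d)} (v : Space d)
    (h : Tendsto (fun k => cfDist (A k) B) atTop (𝓝 0)) :
    Tendsto (fun k => cfDist (v +ᵥ A k) (v +ᵥ B)) atTop (𝓝 0) := by
  rw [Metric.tendsto_atTop] at h ⊢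
  intro e he
  set r : ℝ := min (e / 2) 1 with hr
  have hr0 : 0 < r := lt_min (by linarith) one_pos
  have hre : r ≤ e / 2 := min_le_left _ _
  set s : ℝ := min r (1 / (1 / r + ‖v‖)) with hs
  have hq : 0 < 1 / r + ‖v‖ := by positivity
  have hs0 : 0 < s := lt_min hr0 (by positivity)
  obtain ⟨N, hN⟩ := h s hs0
  refine ⟨N, fun k hk => ?_⟩
  have hk' := hN k hk
  rw [Real.dist_0_eq_abs, abs_of_nonneg (cfDist_nonneg _ _)] at hk' ⊢
  obtain ⟨u, hu, hus⟩ := exists_radius hk' ((min_le_left _ _).trans (min_le_right _ _))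
  have hur : u ≤ r := hus.le.trans (min_le_left _ _)
  have huv : 1 / r + ‖v‖ ≤ 1 / u := (le_one_div hu.1 hq).1 (hus.le.trans (min_le_right _ _))
  have hmem : r ∈ cfRadii (v +ᵥ A k) (v +ᵥ B) :=
    ⟨hr0, half_vadd v hur huv hu.2.1, half_vadd v hur huv hu.2.2⟩
  linarith [cfDist_le hmem]

/-! ### Multiscale substitution schemes -/

/-- A labelled tile with labels in `Fin n`: its type, its scale and its position. -/
structure Label (d n : ℕ) where
  type : Fin n
  scale : ℝ
  pos : Space d

/-- The set `pos + scale • T_type`. -/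
def Label.toSet {d n : ℕ} (T : Fin n → Set (Space d)) (a : Label d n) : Set (Space d) :=
  a.pos +ᵥ (a.scale • T a.type)

/-- A (normalized) multiscale substitution scheme in `ℝ^d`: prototiles `T_1, …, T_n` of unit volume
and, for every `i`, a finite tessellation of `T_i` by translates of the sets `α • T_j`.
Each `α` is less than `1`: the corresponding edge of the associated graph has length
`log (1 / α) > 0`. -/
structure Scheme (d : ℕ) where
  n : ℕ
  proto : Fin n → Set (Space d)
  isTile : ∀ i, IsTile (proto i)
  normalized : ∀ i, volume (proto i) = 1
  rule : Fin n → Set (Label d n)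
  rule_finite : ∀ i, (rule i).Finite
  scale_pos : ∀ i, ∀ a ∈ rule i, 0 < a.scale
  scale_lt_one : ∀ i, ∀ a ∈ rule i, a.scale < 1
  rule_injOn : ∀ i, InjOn (Label.toSet proto) (rule i)
  tessellates : ∀ i, IsTessellation (Label.toSet proto '' rule i) (proto i)

namespace Scheme

variable {d : ℕ} (σ : Scheme d)

/-- The piece of the substituted labelled tile `a` that corresponds to the piece `b` of the
substitution rule for the type of `a`. -/
def child {n : ℕ} (a b : Label d n) : Label d n :=
  ⟨b.type, a.scale * b.scale, a.pos + a.scale • b.pos⟩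

/-- The labelled tiles that occur while `e^t T_i` and all subsequent tiles of volume greater
than `1` are repeatedly substituted. -/
inductive Occurs (t : ℝ) (i : Fin σ.n) : Label d σ.n → Prop
  | root : Occurs t i ⟨i, Real.exp t, 0⟩
  | subst (a b : Label d σ.n) (ha : Occurs t i a) (hvol : 1 < volume (a.toSet σ.proto))
      (hb : b ∈ σ.rule a.type) : Occurs t i (child a b)

/-- The substitution semi-flow `F_t(T_i)`, as a set of labelled tiles: those tiles
that remain when all tiles of volume greater than `1` have been substituted. -/
def flow (t : ℝ) (i : Fin σ.n) : Set (Label d σ.n) :=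
  {a | σ.Occurs t i a ∧ volume (a.toSet σ.proto) ≤ 1}

/-- The patch `F_t(T_i)`. -/
def flowPatch (t : ℝ) (i : Fin σ.n) : Set (Set (Space d)) := Label.toSet σ.proto '' σ.flow t i

/-- The generating patches: all `F_t(T_i)` with `t ≥ 0`. -/
def generatingPatches : Set (Set (Set (Space d))) :=
  {P | ∃ i : Fin σ.n, ∃ t : ℝ, 0 ≤ t ∧ P = σ.flowPatch t i}

/-- For all `i, j`, some `F_t(T_i)` with `t > 0` contains a tile of type `j`. -/
def IsIrreducible : Prop := ∀ i j : Fin σ.n, ∃ t : ℝ, 0 < t ∧ ∃ a ∈ σ.flow t i, a.type = j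

/-- `F_t(T_i)` contains a tile of type `i` and unit volume. -/
def IsReturnTime (i : Fin σ.n) (t : ℝ) : Prop :=
  ∃ a ∈ σ.flow t i, a.type = i ∧ volume (a.toSet σ.proto) = 1

/-- There are positive times `t₁`, `t₂` with `t₁ ∉ ℚ t₂` at which a tile of type `i`, respectively
`j`, and unit volume appears in `F_{t₁}(T_i)`, respectively `F_{t₂}(T_j)`. -/
def IsIncommensurable : Prop :=
  ∃ i j : Fin σ.n, ∃ t₁ t₂ : ℝ, 0 < t₁ ∧ 0 < t₂ ∧ σ.IsReturnTime i t₁ ∧ σ.IsReturnTime j t₂ ∧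
    ¬ ∃ q : ℚ, t₁ = q * t₂

/-- The patch `Q` is a limit of translated sub-patches `v_k + R_k` of generating patches:
the unions of the boundaries of tiles converge with respect to `D`, and the supports
converge in volume. -/
def IsLimitOfLegal (Q : Set (Set (Space d))) : Prop :=
  ∃ (R : ℕ → Set (Set (Space d))) (v : ℕ → Space d),
    (∀ k, ∃ P ∈ σ.generatingPatches, R k ⊆ P) ∧
    Tendsto (fun k => cfDist (bdry (translate (v k) (R k))) (bdry Q)) atTop (𝓝 0) ∧
    Tendsto (fun k => volume (symmDiff (⋃₀ translate (v k) (R k)) (⋃₀ Q))) atTop (𝓝 0)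

/-- `P` is a multiscale substitution tiling: a tiling of `ℝ^d` all of whose sub-patches (bounded
sub-collections of tiles) are limits of translated sub-patches of generating patches. -/
def IsSubstitutionTiling (P : Set (Set (Space d))) : Prop :=
  IsTiling P ∧ ∀ Q ⊆ P, Bornology.IsBounded (⋃₀ Q) → σ.IsLimitOfLegal Q

/-- The multiscale tiling space; a tiling is identified with the union of the boundaries of
its tiles. -/
def tilingSpace : Set (ClosedSubset d) :=
  {C | ∃ P, σ.IsSubstitutionTiling P ∧ C.carrier = bdry P}

end Scheme

/-! ### Translation invariance of the tiling space -/

theorem frontier_vadd_set {d : ℕ} (v : Space d) (T : Set (Space d)) :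
    frontier (v +ᵥ T) = v +ᵥ frontier T :=
  ((Homeomorph.vadd v).image_frontier T).symm

theorem interior_vadd_set {d : ℕ} (v : Space d) (T : Set (Space d)) :
    interior (v +ᵥ T) = v +ᵥ interior T :=
  ((Homeomorph.vadd v).image_interior T).symm

theorem bdry_translate {d : ℕ} (v : Space d) (P : Set (Set (Space d))) :
    bdry (translate v P) = v +ᵥ bdry P := by
  simp only [bdry, translate, biUnion_image, frontier_vadd_set, vadd_set_iUnion]

theorem sUnion_translate {d : ℕ} (v : Space d) (P : Set (Set (Space d))) :
    ⋃₀ translate v P = v +ᵥ ⋃₀ P := by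
  simp only [translate, sUnion_eq_biUnion, biUnion_image, vadd_set_iUnion]

theorem translate_add {d : ℕ} (u v : Space d) (P : Set (Set (Space d))) :
    translate (u + v) P = translate u (translate v P) := by
  simp only [translate, image_image, add_vadd]

theorem translate_zero {d : ℕ} (P : Set (Set (Space d))) : translate 0 P = P := by
  simp [translate]

theorem IsTile.vadd {d : ℕ} {T : Set (Space d)} (h : IsTile T) (v : Space d) :
    IsTile (v +ᵥ T) := by
  refine ⟨h.1.vadd v, h.2.1.vadd v, ?_, ?_⟩
  · rw [measure_vadd]; exact h.2.2.1
  · rw [frontier_vadd_set, measure_vadd]; exact h.2.2.2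

theorem IsTiling.translate {d : ℕ} {P : Set (Set (Space d))} (h : IsTiling P) (v : Space d) :
    IsTiling (translate v P) := by
  obtain ⟨⟨h1, h2, h3⟩, h4⟩ := h
  refine ⟨⟨?_, ?_, ?_⟩, fun r => ?_⟩
  · rintro _ ⟨T, hT, rfl⟩
    exact (h1 T hT).vadd v
  · rintro _ ⟨S, hS, rfl⟩ _ ⟨T, hT, rfl⟩ hne
    have hST : S ≠ T := fun h => hne (by rw [h])
    simp only [interior_vadd_set]
    exact (disjoint_image_iff (AddAction.injective v)).2 (h2 hS hT hST)
  · rw [sUnion_translate, h3, vadd_set_univ]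
  · refine ((h4 (r + ‖v‖)).image (fun T => v +ᵥ T)).subset ?_
    rintro _ ⟨⟨T, hT, rfl⟩, _, ⟨x, hx, rfl⟩, hxr⟩
    refine ⟨T, ⟨hT, x, hx, ?_⟩, rfl⟩
    simp only [vadd_eq_add, mem_ball_zero_iff] at hxr ⊢
    have h1 : ‖x‖ ≤ ‖v + x‖ + ‖v‖ := by
      simpa using norm_sub_le (v + x) v
    linarith

namespace Scheme

variable {d : ℕ} (σ : Scheme d)

theorem IsLimitOfLegal.translate {σ : Scheme d} {Q : Set (Set (Space d))}
    (h : σ.IsLimitOfLegal Q) (u : Space d) : σ.IsLimitOfLegal (translate u Q) := by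
  obtain ⟨R, v, h1, h2, h3⟩ := h
  refine ⟨R, fun k => u + v k, h1, ?_, ?_⟩
  · simpa only [translate_add, bdry_translate u] using tendsto_cfDist_vadd u h2
  · have key : ∀ k, volume (symmDiff (⋃₀ MultiscaleTiling.translate (u + v k) (R k))
        (⋃₀ MultiscaleTiling.translate u Q)) =
        volume (symmDiff (⋃₀ MultiscaleTiling.translate (v k) (R k)) (⋃₀ Q)) := by
      intro k
      rw [translate_add, sUnion_translate u, sUnion_translate u, ← vadd_set_symmDiff, measure_vadd]
    simpa only [key] using h3

theorem vadd_mem_tilingSpace {σ : Scheme d} {C : ClosedSubset d} (v : Space d)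
    (h : C ∈ σ.tilingSpace) : v +ᵥ C ∈ σ.tilingSpace := by
  obtain ⟨P, ⟨hP, hQ⟩, hC⟩ := h
  refine ⟨translate v P, ⟨hP.translate v, fun Q hQP hb => ?_⟩, ?_⟩
  · have hsub : translate (-v) Q ⊆ P := by
      rintro _ ⟨T, hT, rfl⟩
      obtain ⟨S, hS, rfl⟩ := hQP hT
      simpa using hS
    have hb' : Bornology.IsBounded (⋃₀ translate (-v) Q) := by
      rw [sUnion_translate]; exact hb.vadd (-v)
    have := (hQ _ hsub hb').translate v
    rwa [← translate_add, add_neg_cancel, translate_zero] at this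
  · rw [carrier_vadd, hC, bdry_translate]

/-- The translation action of `ℝ^d` on the tiling space. -/
instance : AddAction (Space d) σ.tilingSpace where
  vadd v C := ⟨v +ᵥ C.1, vadd_mem_tilingSpace v C.2⟩
  zero_vadd C := Subtype.ext (zero_vadd _ C.1)
  add_vadd u v C := Subtype.ext (add_vadd u v C.1)

end Scheme

end MultiscaleTiling

namespace MultiscaleTiling

/-! ### Tiles and labelled tiles -/

/-! Existence. Below any prototile, irreducibility yields a smaller copy of itself placed so that
the similarity onto the copy fixes an interior point `p` (`exists_descendant_fixed_point`).
Expanding about `p` by powers of the inverse ratio gives nested patches that exhaust the space.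
Their union is a tiling whose bounded sub-patches are translates of sub-patches of generating
patches (`isSubstitutionTiling_iUnion_patch`).

Minimality. Let `P`, `Q` be two tilings of the space. Two return times with irrational quotient have
non-negative integer combinations that are eventually dense, so every tile of large scale has
descendants of any type at a scale just below any prescribed one
(`exists_descendant_scale_mem_Ioc`). Tiles are cut only when their scale is strictly greater than 1,
an open condition. Hence every large patch contains a copy of a given patch shrunk by a factor close
to 1 (`exists_scaled_copy`).

Near the origin, `Q` resembles a sub-patch `S` of some patch, and `P` resembles on a much larger
ball a sub-patch `R` of another (`exists_approx`). An ancestor of bounded scale of a tile of `R`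
near the origin contains a slightly shrunken copy of `S`. Convergence of supports in volume shows
that this copy lies in `R`, since a missing tile would leave too much volume uncovered. It also
shows that `R` has no other tiles near the centre of the copy, since tiles are uniformly thick
(`exists_volume_ball_inter_interior`). Moving that centre to the origin brings `bdry P` close to
`bdry Q` (`exists_cfDist_vadd_lt`). -/

theorem frontier_smul_set {d : ℕ} {s : ℝ} (hs : s ≠ 0) (T : Set (Space d)) :
    frontier (s • T) = s • frontier T := by
  rw [frontier, closure_smul₀, interior_smul₀ hs, frontier, smul_set_sdiff₀ hs]

theorem IsTile.smul {d : ℕ} {T : Set (Space d)} (h : IsTile T) {s : ℝ} (hs : s ≠ 0) :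
    IsTile (s • T) := by
  have hf : volume (frontier (s • T)) = 0 := by
    rw [frontier_smul_set hs, Measure.addHaar_smul, h.2.2.2, mul_zero]
  refine ⟨h.1.smul₀ s, nullMeasurableSet_of_null_frontier hf, ?_, hf⟩
  rw [Measure.addHaar_smul]
  exact ENNReal.mul_pos (by simpa using pow_ne_zero _ hs) h.2.2.1.ne'

theorem IsTile.volume_interior {d : ℕ} {T : Set (Space d)} (h : IsTile T) :
    volume (interior T) = volume T := by
  refine le_antisymm (measure_mono interior_subset) ?_
  calc volume T ≤ volume (interior T ∪ frontier T) := by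
        refine measure_mono fun x hx => ?_
        by_cases hi : x ∈ interior T
        · exact Or.inl hi
        · exact Or.inr ⟨subset_closure hx, hi⟩
    _ ≤ volume (interior T) + volume (frontier T) := measure_union_le _ _
    _ = volume (interior T) := by rw [h.2.2.2, add_zero]

theorem IsTile.interior_nonempty {d : ℕ} {T : Set (Space d)} (h : IsTile T) :
    (interior T).Nonempty := by
  refine nonempty_of_measure_ne_zero (μ := volume) ?_
  rw [h.volume_interior]
  exact h.2.2.1.ne'

namespace IsTessellation

variable {d : ℕ} {P G : Set (Set (Space d))} {U T : Set (Space d)}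

/-- The interior of a tile meets the union of countably many other tiles in a null set. -/
theorem volume_interior_inter_sUnion (hP : IsTessellation P U) (hG : G ⊆ P) (hc : G.Countable)
    (hT : T ∈ P) (hTG : T ∉ G) : volume (interior T ∩ ⋃₀ G) = 0 := by
  have hsub : interior T ∩ ⋃₀ G ⊆ ⋃ S ∈ G, frontier S := by
    rintro x ⟨hx, S, hS, hxS⟩
    refine mem_biUnion hS ⟨subset_closure hxS, fun hi => ?_⟩
    have hne : T ≠ S := fun h => hTG (h ▸ hS)
    exact (hP.2.1 hT (hG hS) hne).le_bot ⟨hx, hi⟩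
  refine measure_mono_null hsub ((measure_biUnion_null_iff hc).2 fun S hS => ?_)
  exact (hP.1 S (hG hS)).2.2.2

end IsTessellation

theorem bdry_mono {d : ℕ} {P Q : Set (Set (Space d))} (h : P ⊆ Q) : bdry P ⊆ bdry Q :=
  biUnion_subset_biUnion_left h

theorem mem_bdry {d : ℕ} {P : Set (Set (Space d))} {x : Space d} :
    x ∈ bdry P ↔ ∃ T ∈ P, x ∈ frontier T := by
  simp [bdry]

theorem translate_mono {d : ℕ} {P Q : Set (Set (Space d))} (h : P ⊆ Q) (v : Space d) :
    translate v P ⊆ translate v Q :=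
  image_mono h

namespace Label

variable {d n : ℕ} {T : Fin n → Set (Space d)} {a b c : Label d n}

theorem mem_toSet {x : Space d} :
    x ∈ a.toSet T ↔ ∃ y ∈ T a.type, a.pos + a.scale • y = x := by
  simp [toSet, mem_vadd_set, mem_smul_set]

theorem interior_toSet (ha : a.scale ≠ 0) :
    interior (a.toSet T) = a.pos +ᵥ a.scale • interior (T a.type) := by
  rw [toSet, interior_vadd_set, interior_smul₀ ha]

theorem closure_toSet : closure (a.toSet T) = a.pos +ᵥ a.scale • closure (T a.type) := by
  rw [toSet, ← closure_smul₀]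
  exact ((Homeomorph.vadd a.pos).image_closure _).symm

theorem toSet_child (a b : Label d n) :
    (Scheme.child a b).toSet T = a.pos +ᵥ (a.scale • b.toSet T) := by
  ext x
  simp only [Scheme.child, mem_toSet, mem_vadd_set, mem_smul_set]
  constructor
  · rintro ⟨y, hy, rfl⟩
    exact ⟨a.scale • (b.pos + b.scale • y), ⟨_, ⟨y, hy, rfl⟩, rfl⟩, by
      simp [smul_add, mul_smul, add_assoc]⟩
  · rintro ⟨_, ⟨_, ⟨y, hy, rfl⟩, rfl⟩, rfl⟩
    exact ⟨y, hy, by simp [smul_add, mul_smul, add_assoc]⟩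

theorem child_assoc (a b c : Label d n) :
    Scheme.child (Scheme.child a b) c = Scheme.child a (Scheme.child b c) := by
  simp [Scheme.child, mul_assoc, smul_add, mul_smul, add_assoc]

theorem child_unit (a : Label d n) {i : Fin n} (h : a.type = i) :
    Scheme.child a ⟨i, 1, 0⟩ = a := by
  subst h
  simp [Scheme.child]

theorem child_monotone (h : b.toSet T ⊆ c.toSet T) :
    (Scheme.child a b).toSet T ⊆ (Scheme.child a c).toSet T := by
  rw [toSet_child, toSet_child]
  exact vadd_set_mono (smul_set_mono h)

theorem dist_le_of_mem_closure {D : ℝ} (hD : ∀ i, T i ⊆ Metric.closedBall 0 D) (ha : 0 ≤ a.scale)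
    {x y : Space d} (hx : x ∈ closure (a.toSet T)) (hy : y ∈ closure (a.toSet T)) :
    dist x y ≤ a.scale * (2 * D) := by
  rw [closure_toSet] at hx hy
  obtain ⟨_, ⟨x, hx, rfl⟩, rfl⟩ := hx
  obtain ⟨_, ⟨y, hy, rfl⟩, rfl⟩ := hy
  have h := closure_minimal (hD a.type) Metric.isClosed_closedBall
  have h1 := mem_closedBall_zero_iff.1 (h hx)
  have h2 := mem_closedBall_zero_iff.1 (h hy)
  simp only [vadd_eq_add, dist_add_left]
  rw [dist_smul₀, Real.norm_of_nonneg ha]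
  gcongr
  linarith [dist_le_norm_add_norm x y]

end Label

namespace Scheme

variable {d : ℕ} (σ : Scheme d)

/-! ### Constants of a scheme -/

theorem exists_scale_bounds : ∃ m M : ℝ, 0 < m ∧ m < 1 ∧ 0 < M ∧ M < 1 ∧
    ∀ i, ∀ a ∈ σ.rule i, m ≤ a.scale ∧ a.scale ≤ M := by
  -- The value 1/2 keeps the set nonempty, with elements in (0, 1), even without prototiles.
  set S : Set ℝ := insert (1 / 2) (⋃ i, Label.scale '' σ.rule i) with hS
  have hfin : S.Finite := (finite_iUnion fun i => (σ.rule_finite i).image _).insert _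
  have hpos : ∀ s ∈ S, 0 < s ∧ s < 1 := by
    rintro s (rfl | hs)
    · norm_num
    · obtain ⟨i, a, ha, rfl⟩ := mem_iUnion.1 hs
      exact ⟨σ.scale_pos i a ha, σ.scale_lt_one i a ha⟩
  have hne : S.Nonempty := ⟨_, mem_insert _ _⟩
  obtain ⟨m, hm, hm'⟩ := exists_min_image S id hfin hne
  obtain ⟨M, hM, hM'⟩ := exists_max_image S id hfin hne
  have hmem : ∀ i, ∀ a ∈ σ.rule i, a.scale ∈ S := fun i a ha =>
    Or.inr (mem_iUnion.2 ⟨i, a, ha, rfl⟩)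
  exact ⟨m, M, (hpos m hm).1, (hpos m hm).2, (hpos M hM).1, (hpos M hM).2,
    fun i a ha => ⟨hm' _ (hmem i a ha), hM' _ (hmem i a ha)⟩⟩

theorem exists_proto_bound : ∃ D : ℝ, 0 < D ∧ ∀ i, σ.proto i ⊆ Metric.closedBall 0 D := by
  have hb : Bornology.IsBounded (⋃ i, σ.proto i) :=
    Bornology.isBounded_iUnion.2 fun i => (σ.isTile i).1
  obtain ⟨D, hD, h⟩ := hb.subset_closedBall_lt 0 0
  exact ⟨D, hD, fun i => (subset_iUnion _ i).trans h⟩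

variable {σ}

theorem isTile_toSet {a : Label d σ.n} (ha : 0 < a.scale) : IsTile (a.toSet σ.proto) :=
  ((σ.isTile a.type).smul ha.ne').vadd a.pos

theorem volume_toSet {a : Label d σ.n} (ha : 0 < a.scale) :
    volume (a.toSet σ.proto) = ENNReal.ofReal (a.scale ^ d) := by
  rw [Label.toSet, measure_vadd, Measure.addHaar_smul, σ.normalized, mul_one, finrank_euclideanSpace,
    Fintype.card_fin, abs_of_nonneg (pow_nonneg ha.le _)]

theorem volume_toSet_le_one_iff (hd : 0 < d) {a : Label d σ.n} (ha : 0 < a.scale) :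
    volume (a.toSet σ.proto) ≤ 1 ↔ a.scale ≤ 1 := by
  rw [volume_toSet ha, ENNReal.ofReal_le_one, pow_le_one_iff_of_nonneg ha.le hd.ne']

theorem volume_toSet_eq_one_iff (hd : 0 < d) {a : Label d σ.n} (ha : 0 < a.scale) :
    volume (a.toSet σ.proto) = 1 ↔ a.scale = 1 := by
  rw [volume_toSet ha, ENNReal.ofReal_eq_one, pow_eq_one_iff_of_nonneg ha.le hd.ne']

theorem toSet_child_subset {a b : Label d σ.n} (hb : b ∈ σ.rule a.type) :
    (child a b).toSet σ.proto ⊆ a.toSet σ.proto := by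
  rw [Label.toSet_child, Label.toSet]
  refine vadd_set_mono (smul_set_mono ?_)
  rw [← (σ.tessellates a.type).2.2]
  exact subset_sUnion_of_mem (mem_image_of_mem _ hb)

theorem exists_mem_toSet_child {a : Label d σ.n} {x : Space d} (hx : x ∈ a.toSet σ.proto) :
    ∃ b ∈ σ.rule a.type, x ∈ (child a b).toSet σ.proto := by
  obtain ⟨y, hy, rfl⟩ := Label.mem_toSet.1 hx
  rw [← (σ.tessellates a.type).2.2] at hy
  obtain ⟨_, ⟨b, hb, rfl⟩, hyb⟩ := hy
  refine ⟨b, hb, ?_⟩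
  rw [Label.toSet_child]
  exact ⟨_, ⟨y, hyb, rfl⟩, rfl⟩

variable (σ)

/-- Prototiles are contained in the closure of their interior. -/
theorem proto_subset_closure_interior (i : Fin σ.n) :
    σ.proto i ⊆ closure (interior (σ.proto i)) := by
  obtain ⟨m, M, -, -, hM0, hM1, hmM⟩ := σ.exists_scale_bounds
  obtain ⟨D, hD0, hD⟩ := σ.exists_proto_bound
  -- Passing to a piece of the rule that contains `x` shrinks the distance to an interior point by a
  -- factor at most `M`.
  have key : ∀ N : ℕ, ∀ i, ∀ x ∈ σ.proto i, ∃ y ∈ interior (σ.proto i),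
      dist x y ≤ M ^ N * (2 * D) := by
    intro N
    induction N with
    | zero =>
      intro i x hx
      obtain ⟨y, hy⟩ := (σ.isTile i).interior_nonempty
      refine ⟨y, hy, ?_⟩
      have h1 := mem_closedBall_zero_iff.1 (hD i hx)
      have h2 := mem_closedBall_zero_iff.1 (hD i (interior_subset hy))
      linarith [dist_le_norm_add_norm x y]
    | succ N ih =>
      intro i x hx
      have hx' := hx
      rw [← (σ.tessellates i).2.2] at hx'
      obtain ⟨_, ⟨b, hb, rfl⟩, hxb⟩ := hx'
      obtain ⟨x', hx', rfl⟩ := Label.mem_toSet.1 hxb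
      obtain ⟨y', hy', hxy⟩ := ih b.type x' hx'
      have hb0 := σ.scale_pos i b hb
      refine ⟨b.pos + b.scale • y', ?_, ?_⟩
      · have hsub : b.toSet σ.proto ⊆ σ.proto i := by
          rw [← (σ.tessellates i).2.2]
          exact subset_sUnion_of_mem (mem_image_of_mem _ hb)
        refine interior_mono hsub ?_
        rw [Label.interior_toSet hb0.ne']
        exact ⟨_, ⟨y', hy', rfl⟩, rfl⟩
      · rw [dist_add_left, dist_smul₀, Real.norm_of_nonneg hb0.le, pow_succ', mul_assoc]
        exact mul_le_mul (hmM i b hb).2 hxy dist_nonneg hM0.le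
  intro x hx
  refine Metric.mem_closure_iff.2 fun e he => ?_
  have hlim : Tendsto (fun N : ℕ => M ^ N * (2 * D)) atTop (𝓝 (0 * (2 * D))) :=
    (tendsto_pow_atTop_nhds_zero_of_lt_one hM0.le hM1).mul_const _
  rw [zero_mul] at hlim
  obtain ⟨N, hN⟩ := (hlim.eventually_lt_const he).exists
  obtain ⟨y, hy, hxy⟩ := key N i x hx
  exact ⟨y, hy, hxy.trans_lt hN⟩

/-- Near a point `z` of the closure, the ball of radius `e / 2` around `z` lies in every ball of
radius `e` in question and meets the interior in a nonempty open set. Compactness of the closure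
makes the bound uniform. -/
theorem exists_volume_ball_inter_interior_proto (i : Fin σ.n) {e : ℝ} (he : 0 < e) :
    ∃ κ : ENNReal, 0 < κ ∧ ∀ x ∈ closure (σ.proto i),
      κ ≤ volume (Metric.ball x e ∩ interior (σ.proto i)) := by
  have hK : IsCompact (closure (σ.proto i)) :=
    Metric.isCompact_of_isClosed_isBounded isClosed_closure (σ.isTile i).1.closure
  refine hK.induction_on (p := fun s => ∃ κ : ENNReal, 0 < κ ∧ ∀ x ∈ s,
      κ ≤ volume (Metric.ball x e ∩ interior (σ.proto i))) ⟨1, one_pos, by simp⟩ ?_ ?_ ?_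
  · rintro s t hst ⟨κ, h0, h⟩
    exact ⟨κ, h0, fun x hx => h x (hst hx)⟩
  · rintro s t ⟨κ, h0, h⟩ ⟨κ', h0', h'⟩
    refine ⟨min κ κ', lt_min h0 h0', ?_⟩
    rintro x (hx | hx)
    · exact (min_le_left _ _).trans (h x hx)
    · exact (min_le_right _ _).trans (h' x hx)
  · intro z hz
    refine ⟨Metric.ball z (e / 2), mem_nhdsWithin_of_mem_nhds (Metric.ball_mem_nhds z (by linarith)),
      volume (Metric.ball z (e / 2) ∩ interior (σ.proto i)), ?_, fun x hx => ?_⟩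
    · have hz' : z ∈ closure (interior (σ.proto i)) :=
        closure_minimal (σ.proto_subset_closure_interior i) isClosed_closure hz
      exact (Metric.isOpen_ball.inter isOpen_interior).measure_pos volume
        (mem_closure_iff.1 hz' _ Metric.isOpen_ball (Metric.mem_ball_self (by linarith)))
    · refine measure_mono (inter_subset_inter_left _ (Metric.ball_subset_ball' ?_))
      rw [dist_comm]
      linarith [Metric.mem_ball.1 hx]

/-- Tiles of scale in `[m, 1]` are uniformly thick around the points of their closures. -/
theorem exists_volume_ball_inter_interior {m e : ℝ} (hm : 0 < m) (he : 0 < e) :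
    ∃ κ : ENNReal, 0 < κ ∧ ∀ a : Label d σ.n, m ≤ a.scale → a.scale ≤ 1 →
      ∀ x ∈ closure (a.toSet σ.proto),
        κ ≤ volume (Metric.ball x e ∩ interior (a.toSet σ.proto)) := by
  choose κ hκ0 hκ using fun i => σ.exists_volume_ball_inter_interior_proto i he
  have hfin : (insert 1 (range κ)).Finite := (finite_range κ).insert _
  obtain ⟨κ₀, hmem, hmin⟩ := exists_min_image _ id hfin ⟨1, mem_insert _ _⟩
  have hκ₀ : 0 < κ₀ := by
    rcases hmem with rfl | ⟨i, rfl⟩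
    · exact one_pos
    · exact hκ0 i
  -- Scaling by a factor in `[m, 1]` keeps an `e`-ball within radius `e` and multiplies volumes by
  -- at least `m ^ d`.
  refine ⟨ENNReal.ofReal (m ^ d) * κ₀,
    ENNReal.mul_pos (by simpa using pow_pos hm d) hκ₀.ne', fun a ha ha1 x hx => ?_⟩
  have ha0 : 0 < a.scale := hm.trans_le ha
  rw [Label.closure_toSet] at hx
  obtain ⟨_, ⟨y, hy, rfl⟩, rfl⟩ := hx
  have hsub : a.pos +ᵥ a.scale • (Metric.ball y e ∩ interior (σ.proto a.type)) ⊆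
      Metric.ball (a.pos +ᵥ a.scale • y) e ∩ interior (a.toSet σ.proto) := by
    rintro _ ⟨_, ⟨z, ⟨hz, hzi⟩, rfl⟩, rfl⟩
    refine ⟨?_, ?_⟩
    · simp only [vadd_eq_add, Metric.mem_ball, dist_add_left]
      rw [dist_smul₀, Real.norm_of_nonneg ha0.le]
      exact (mul_le_of_le_one_left dist_nonneg ha1).trans_lt (Metric.mem_ball.1 hz)
    · rw [Label.interior_toSet ha0.ne']
      exact ⟨_, ⟨z, hzi, rfl⟩, rfl⟩
  refine le_trans ?_ (measure_mono hsub)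
  rw [measure_vadd, Measure.addHaar_smul, finrank_euclideanSpace, Fintype.card_fin]
  gcongr
  · exact (pow_le_pow_left₀ hm.le ha d).trans (le_abs_self _)
  · exact (hmin _ (Or.inr (mem_range_self a.type))).trans (hκ a.type y hy)

/-! ### Substituting a labelled tile -/

/-- The labelled tiles that occur while `c` and all subsequent tiles of scale greater than `1` are
repeatedly substituted. -/
inductive OccursIn (c : Label d σ.n) : Label d σ.n → Prop
  | root : OccursIn c c
  | subst (a b : Label d σ.n) (ha : OccursIn c a) (hs : 1 < a.scale) (hb : b ∈ σ.rule a.type) :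
      OccursIn c (child a b)

/-- The patch obtained from the labelled tile `c` by substituting all tiles of scale greater
than `1`. -/
def patch (c : Label d σ.n) : Set (Set (Space d)) :=
  Label.toSet σ.proto '' {a | σ.OccursIn c a ∧ a.scale ≤ 1}

/-- The labelled tiles that occur in iterated substitutions of the prototile of type `i`. -/
inductive Descendant (i : Fin σ.n) : Label d σ.n → Prop
  | root : Descendant i ⟨i, 1, 0⟩
  | subst (a b : Label d σ.n) (ha : Descendant i a) (hb : b ∈ σ.rule a.type) :
      Descendant i (child a b)

variable {σ}

namespace OccursIn

variable {a b c : Label d σ.n}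

theorem scale_pos (h : σ.OccursIn c a) (hc : 0 < c.scale) : 0 < a.scale := by
  induction h with
  | root => exact hc
  | subst a b _ _ hb ih => exact mul_pos ih (σ.scale_pos _ b hb)

theorem trans (h : σ.OccursIn c a) (h' : σ.OccursIn a b) : σ.OccursIn c b := by
  induction h' with
  | root => exact h
  | subst b e _ hs he ih => exact .subst b e ih hs he

theorem toSet_subset (h : σ.OccursIn c a) : a.toSet σ.proto ⊆ c.toSet σ.proto := by
  induction h with
  | root => exact subset_rfl
  | subst a b _ _ hb ih => exact (toSet_child_subset hb).trans ih

/-- A tile other than `c` was cut from a parent of scale greater than 1, and a cut retains at least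
the fraction `m` of the scale. -/
theorem le_scale {m : ℝ} (hm1 : m ≤ 1) (hm : ∀ i, ∀ a ∈ σ.rule i, m ≤ a.scale)
    (h : σ.OccursIn c a) (hc : 1 ≤ c.scale) : m ≤ a.scale := by
  cases h with
  | root => exact hm1.trans hc
  | subst a b _ hs hb =>
    exact (hm _ b hb).trans (le_mul_of_one_le_left (σ.scale_pos _ b hb).le hs.le)

/-- `OccursIn` grows at the leaves; reading off the first cut at the root instead gives the
recursion for patches. -/
theorem eq_or_exists (h : σ.OccursIn c a) :
    a = c ∨ 1 < c.scale ∧ ∃ b ∈ σ.rule c.type, σ.OccursIn (child c b) a := by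
  induction h with
  | root => exact Or.inl rfl
  | subst a e _ hs he ih =>
    rcases ih with rfl | ⟨h1, b, hb, hab⟩
    · exact Or.inr ⟨hs, e, he, .root⟩
    · exact Or.inr ⟨h1, b, hb, .subst a e hab hs he⟩

/-- Every tile that occurs in `c` has an ancestor of roughly any prescribed scale. -/
theorem exists_ancestor {m s : ℝ} (hm0 : 0 ≤ m) (hm : ∀ i, ∀ a ∈ σ.rule i, m ≤ a.scale)
    (h : σ.OccursIn c b) (hb : b.scale ≤ s) (hc : s < c.scale) :
    ∃ a, σ.OccursIn c a ∧ m * s ≤ a.scale ∧ a.scale ≤ s ∧ σ.OccursIn a b := by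
  induction h with
  | root => exact absurd hc hb.not_gt
  | subst a e ha h1 he ih =>
    by_cases hs : a.scale ≤ s
    · obtain ⟨a', h1', h2, h3, h4⟩ := ih hs
      exact ⟨a', h1', h2, h3, .subst a e h4 h1 he⟩
    -- The parent still exceeds `s`, so its child is the first tile of scale at most `s` on the way
    -- to `b`.
    · refine ⟨child a e, .subst a e ha h1 he, ?_, hb, .root⟩
      have h0 := hm _ e he
      push Not at hs
      calc m * s ≤ m * a.scale := mul_le_mul_of_nonneg_left hs.le hm0
        _ = a.scale * m := mul_comm _ _
        _ ≤ a.scale * e.scale := mul_le_mul_of_nonneg_left h0 (by linarith)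

/-- Occurrence is preserved under similarities with ratio slightly below `1`. -/
theorem eventually_child (h : σ.OccursIn c a) : ∀ᶠ η in 𝓝 (1 : ℝ), ∀ g : Label d σ.n,
    g.scale = η → σ.OccursIn (child g c) (child g a) := by
  induction h with
  | root => exact Eventually.of_forall fun _ _ _ => .root
  | subst a b _ hs hb ih =>
    -- The strict inequality that allows the cut persists for ratios near 1.
    have hlim : Tendsto (fun η : ℝ => η * a.scale) (𝓝 1) (𝓝 (1 * a.scale)) :=
      tendsto_id.mul_const _
    rw [one_mul] at hlim
    filter_upwards [ih, hlim.eventually_const_lt hs] with η h1 h2 g hg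
    rw [← Label.child_assoc]
    refine .subst (child g a) b (h1 g hg) ?_ hb
    change 1 < g.scale * a.scale
    rwa [hg]

end OccursIn

namespace Descendant

variable {i : Fin σ.n} {a b : Label d σ.n}

theorem scale_pos (h : σ.Descendant i a) : 0 < a.scale := by
  induction h with
  | root => exact one_pos
  | subst a b _ hb ih => exact mul_pos ih (σ.scale_pos _ b hb)

theorem toSet_subset (h : σ.Descendant i a) : a.toSet σ.proto ⊆ σ.proto i := by
  induction h with
  | root => simp [Label.toSet]
  | subst a b _ hb ih => exact (toSet_child_subset hb).trans ih

theorem trans (h : σ.Descendant i a) (h' : σ.Descendant a.type b) :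
    σ.Descendant i (child a b) := by
  induction h' with
  | root => rwa [Label.child_unit a rfl]
  | subst b e _ he ih =>
    rw [← Label.child_assoc]
    exact .subst _ e ih he

theorem scale_le_one (h : σ.Descendant i a) : a.scale ≤ 1 := by
  induction h with
  | root => exact le_rfl
  | subst a b ha hb ih =>
    exact mul_le_one₀ ih (σ.scale_pos _ b hb).le (σ.scale_lt_one _ b hb).le

/-- A descendant whose scale, relative to `c`, exceeds all scales of the substitution rule occurs in
the substitution of `c`. -/
theorem occursIn {M : ℝ} (hM0 : 0 < M) (hM : ∀ i, ∀ a ∈ σ.rule i, a.scale ≤ M)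
    (h : σ.Descendant i b) {c : Label d σ.n} (hi : c.type = i) (hc : 0 < c.scale)
    (hs : M < c.scale * b.scale) : σ.OccursIn c (child c b) := by
  induction h with
  | root => rw [Label.child_unit c hi]; exact .root
  | subst a e ha he ih =>
    have ha0 : 0 < c.scale * a.scale := mul_pos hc ha.scale_pos
    have he1 : e.scale ≤ M := hM _ e he
    have he0 := σ.scale_pos _ e he
    have h1 : c.scale * (child a e).scale = c.scale * a.scale * e.scale :=
      (mul_assoc _ _ _).symm
    rw [h1] at hs
    -- A cut leaves at most the fraction `M` of the scale, so the parent of a tile of scale above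
    -- `M` has scale above 1 and is really cut.
    have h2 : 1 < c.scale * a.scale := by
      by_contra hcon
      push Not at hcon
      nlinarith
    rw [← Label.child_assoc]
    refine .subst (child c a) e (ih ?_) h2 he
    exact hs.trans_le (mul_le_of_le_one_right ha0.le (σ.scale_lt_one _ e he).le)

end Descendant

theorem OccursIn.exists_descendant {c a : Label d σ.n} (h : σ.OccursIn c a) :
    ∃ b, σ.Descendant c.type b ∧ a = child c b := by
  induction h with
  | root => exact ⟨_, .root, (Label.child_unit c rfl).symm⟩
  | subst a e _ _ he ih =>
    obtain ⟨b, hb, rfl⟩ := ih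
    exact ⟨child b e, .subst b e hb he, Label.child_assoc _ _ _⟩

/-! ### Patches -/

theorem patch_of_scale_le_one {c : Label d σ.n} (hc : c.scale ≤ 1) :
    σ.patch c = {c.toSet σ.proto} := by
  refine Subset.antisymm ?_ (singleton_subset_iff.2 ⟨c, ⟨.root, hc⟩, rfl⟩)
  rintro _ ⟨a, ⟨h, -⟩, rfl⟩
  rcases h.eq_or_exists with rfl | ⟨h1, -⟩
  · rfl
  · exact absurd hc h1.not_ge

theorem patch_of_one_lt_scale {c : Label d σ.n} (hc : 1 < c.scale) :
    σ.patch c = ⋃ b ∈ σ.rule c.type, σ.patch (child c b) := by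
  ext T
  simp only [mem_iUnion]
  constructor
  · rintro ⟨a, ⟨h, h1⟩, rfl⟩
    rcases h.eq_or_exists with rfl | ⟨-, b, hb, hba⟩
    · exact absurd h1 hc.not_ge
    · exact ⟨b, hb, a, ⟨hba, h1⟩, rfl⟩
  · rintro ⟨b, hb, a, ⟨h, h1⟩, rfl⟩
    exact ⟨a, ⟨(OccursIn.subst c b .root hc hb).trans h, h1⟩, rfl⟩

theorem patch_mono {c a : Label d σ.n} (h : σ.OccursIn c a) : σ.patch a ⊆ σ.patch c := by
  rintro _ ⟨b, ⟨hb, h1⟩, rfl⟩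
  exact ⟨b, ⟨h.trans hb, h1⟩, rfl⟩

/-- Each cut multiplies the scale by at most `M < 1`, so the substitution process terminates. -/
theorem scale_induction {p : Label d σ.n → Prop} (h1 : ∀ c, c.scale ≤ 1 → p c)
    (h2 : ∀ c, 1 < c.scale → (∀ b ∈ σ.rule c.type, p (child c b)) → p c) (c : Label d σ.n) :
    p c := by
  obtain ⟨m, M, -, -, hM0, hM1, hmM⟩ := σ.exists_scale_bounds
  have key : ∀ N : ℕ, ∀ c : Label d σ.n, c.scale * M ^ N ≤ 1 → p c := by
    intro N
    induction N with
    | zero => intro c hc; exact h1 c (by simpa using hc)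
    | succ N ih =>
      intro c hc
      by_cases hs : c.scale ≤ 1
      · exact h1 c hs
      push Not at hs
      refine h2 c hs fun b hb => ih _ ?_
      calc c.scale * b.scale * M ^ N ≤ c.scale * M * M ^ N := by
            gcongr
            exact (hmM _ b hb).2
        _ = c.scale * M ^ (N + 1) := by ring
        _ ≤ 1 := hc
  have hlim : Tendsto (fun N : ℕ => c.scale * M ^ N) atTop (𝓝 (c.scale * 0)) :=
    (tendsto_pow_atTop_nhds_zero_of_lt_one hM0.le hM1).const_mul _
  rw [mul_zero] at hlim
  obtain ⟨N, hN⟩ := (hlim.eventually_le_const one_pos).exists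
  exact key N c hN

variable (σ) in
theorem finite_occursIn (c : Label d σ.n) : {a | σ.OccursIn c a}.Finite := by
  refine scale_induction (p := fun c => {a | σ.OccursIn c a}.Finite) ?_ ?_ c
  · intro c hc
    refine (finite_singleton c).subset fun a ha => ?_
    rcases OccursIn.eq_or_exists ha with rfl | ⟨h1, -⟩
    · rfl
    · exact absurd hc h1.not_ge
  · intro c _ ih
    refine (((σ.rule_finite c.type).biUnion ih).insert c).subset fun a ha => ?_
    rcases OccursIn.eq_or_exists ha with rfl | ⟨-, b, hb, hba⟩
    · exact mem_insert _ _
    · exact Or.inr (mem_biUnion hb hba)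

variable (σ) in
theorem finite_patch (c : Label d σ.n) : (σ.patch c).Finite :=
  ((σ.finite_occursIn c).subset fun _ h => h.1).image _

theorem sUnion_patch (c : Label d σ.n) : ⋃₀ σ.patch c = c.toSet σ.proto := by
  refine Subset.antisymm ?_ ?_
  · rintro x ⟨_, ⟨a, ⟨h, -⟩, rfl⟩, hx⟩
    exact h.toSet_subset hx
  · refine scale_induction (p := fun c => c.toSet σ.proto ⊆ ⋃₀ σ.patch c) ?_ ?_ c
    · intro c hc
      simp [patch_of_scale_le_one hc]
    · intro c hc ih x hx
      obtain ⟨b, hb, hxb⟩ := exists_mem_toSet_child hx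
      rw [patch_of_one_lt_scale hc]
      obtain ⟨T, hT, hxT⟩ := ih b hb hxb
      exact ⟨T, mem_biUnion hb hT, hxT⟩

theorem pairwise_patch {c : Label d σ.n} (hc : 0 < c.scale) :
    (σ.patch c).Pairwise (fun S T => Disjoint (interior S) (interior T)) := by
  revert hc
  refine scale_induction (p := fun c => 0 < c.scale → (σ.patch c).Pairwise
    (fun S T => Disjoint (interior S) (interior T))) ?_ ?_ c
  · intro c hc _
    rw [patch_of_scale_le_one hc]
    exact pairwise_singleton _ _
  · intro c hc ih h0
    rw [patch_of_one_lt_scale hc]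
    intro S hS T hT hne
    obtain ⟨b, hb, hSb⟩ := mem_iUnion₂.1 hS
    obtain ⟨e, he, hTe⟩ := mem_iUnion₂.1 hT
    by_cases hbe : b = e
    · subst hbe
      exact ih b hb (mul_pos h0 (σ.scale_pos _ b hb)) hSb hTe hne
    · have hsub : ∀ {b S}, S ∈ σ.patch (child c b) →
          interior S ⊆ c.pos +ᵥ c.scale • interior (b.toSet σ.proto) := by
        intro b S hS
        rw [← interior_smul₀ h0.ne', ← interior_vadd_set, ← Label.toSet_child, ← sUnion_patch]
        exact interior_mono (subset_sUnion_of_mem hS)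
      -- Tiles from different pieces are separated by the rule itself; distinct labels are distinct
      -- pieces by `rule_injOn`.
      have hdis : Disjoint (interior (b.toSet σ.proto)) (interior (e.toSet σ.proto)) :=
        (σ.tessellates c.type).2.1 (mem_image_of_mem _ hb) (mem_image_of_mem _ he)
          fun h => hbe (σ.rule_injOn _ hb he h)
      refine Disjoint.mono (hsub hSb) (hsub hTe) ?_
      refine (disjoint_image_iff (AddAction.injective c.pos)).2 ?_
      exact (disjoint_image_iff (smul_right_injective _ h0.ne')).2 hdis

theorem isTessellation_patch {c : Label d σ.n} (hc : 0 < c.scale) :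
    IsTessellation (σ.patch c) (c.toSet σ.proto) := by
  refine ⟨?_, pairwise_patch hc, sUnion_patch c⟩
  rintro _ ⟨a, ⟨h, -⟩, rfl⟩
  exact isTile_toSet (h.scale_pos hc)

/-! ### Generating patches -/

theorem Occurs.scale_pos {t : ℝ} {i : Fin σ.n} {a : Label d σ.n} (h : σ.Occurs t i a) :
    0 < a.scale := by
  induction h with
  | root => exact Real.exp_pos t
  | subst a b _ _ hb ih => exact mul_pos ih (σ.scale_pos _ b hb)

/-- A tile has volume `scale ^ d`, which for `d > 0` exceeds 1 exactly when the scale does, so both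
processes cut the same tiles. -/
theorem occurs_iff (hd : 0 < d) {t : ℝ} {i : Fin σ.n} {a : Label d σ.n} :
    σ.Occurs t i a ↔ σ.OccursIn ⟨i, Real.exp t, 0⟩ a := by
  constructor
  · intro h
    induction h with
    | root => exact .root
    | subst a b ha hvol hb ih =>
      refine .subst a b ih (lt_of_not_ge fun h => hvol.not_ge ?_) hb
      exact (volume_toSet_le_one_iff hd ha.scale_pos).2 h
  · intro h
    induction h with
    | root => exact .root
    | subst a b ha hs hb ih =>
      refine .subst a b ih (lt_of_not_ge fun h => hs.not_ge ?_) hb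
      exact (volume_toSet_le_one_iff hd ih.scale_pos).1 h

theorem mem_flow_iff (hd : 0 < d) {t : ℝ} {i : Fin σ.n} {a : Label d σ.n} :
    a ∈ σ.flow t i ↔ σ.OccursIn ⟨i, Real.exp t, 0⟩ a ∧ a.scale ≤ 1 := by
  change _ ∧ _ ↔ _
  rw [occurs_iff hd]
  refine and_congr_right fun h => ?_
  exact volume_toSet_le_one_iff hd (h.scale_pos (Real.exp_pos t))

theorem flowPatch_eq (hd : 0 < d) (t : ℝ) (i : Fin σ.n) :
    σ.flowPatch t i = σ.patch ⟨i, Real.exp t, 0⟩ := by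
  rw [flowPatch, patch]
  congr 1
  ext a
  exact mem_flow_iff hd

/-- The neighbourhood statement is evaluated at its centre; ratio 1 means that substitution commutes
with translations. -/
theorem OccursIn.child_of_scale_eq_one {c a g : Label d σ.n} (h : σ.OccursIn c a)
    (hg : g.scale = 1) : σ.OccursIn (child g c) (child g a) := by
  exact h.eventually_child.self_of_nhds g hg

theorem translate_patch (v : Space d) (c : Label d σ.n) :
    translate v (σ.patch c) = σ.patch ⟨c.type, c.scale, v + c.pos⟩ := by
  have key : ∀ (v : Space d) (c : Label d σ.n),
      translate v (σ.patch c) ⊆ σ.patch ⟨c.type, c.scale, v + c.pos⟩ := by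
    rintro v c _ ⟨_, ⟨a, ⟨h, h1⟩, rfl⟩, rfl⟩
    have h' := h.child_of_scale_eq_one (g := ⟨c.type, 1, v⟩) rfl
    simp only [child, one_mul, one_smul] at h'
    exact ⟨_, ⟨h', h1⟩, by simp [Label.toSet, add_vadd]⟩
  refine (key v c).antisymm ?_
  have h := translate_mono (key (-v) ⟨c.type, c.scale, v + c.pos⟩) v
  rwa [← translate_add, add_neg_cancel, translate_zero, neg_add_cancel_left] at h

end Scheme

/-- The sums `m a + n b` of two incommensurable positive numbers are eventually dense. -/
theorem exists_nat_combination_mem_Ico {a b δ : ℝ} (ha : 0 < a)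
    (hirr : Irrational (a / b)) (hδ : 0 < δ) :
    ∃ N : ℝ, ∀ x, N ≤ x → ∃ m n : ℕ, x ≤ m * a + n * b ∧ m * a + n * b < x + δ := by
  obtain ⟨g, hgδ, hg⟩ := (dense_addSubgroupClosure_pair_iff.2 hirr).exists_mem_open
    isOpen_Ioo (nonempty_Ioo.2 hδ)
  -- The small step `g` may have coefficients of either sign. Starting from the offset `w` below
  -- keeps the coefficients non-negative for up to `K` such steps. Steps of size `a` from `w` leave
  -- a remainder below `a`, which at most `K` steps of size `g` cover with an overshoot less than
  -- `δ`.
  obtain ⟨m₀, n₀, hmn⟩ := AddSubgroup.mem_closure_pair.1 hgδ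
  simp only [zsmul_eq_mul] at hmn
  obtain ⟨K, hK⟩ := exists_nat_ge (a / g)
  refine ⟨K * |(m₀ : ℝ)| * a + K * |(n₀ : ℝ)| * b, fun x hx => ?_⟩
  set w : ℝ := K * |(m₀ : ℝ)| * a + K * |(n₀ : ℝ)| * b with hw
  set q : ℕ := ⌊(x - w) / a⌋₊ with hq
  have hq1 : q * a ≤ x - w := by
    rw [← le_div_iff₀ ha]
    exact Nat.floor_le (div_nonneg (by linarith) ha.le)
  have hq2 : x - w < (q + 1) * a := by
    rw [← div_lt_iff₀ ha]
    exact Nat.lt_floor_add_one _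
  set ρ : ℝ := x - w - q * a with hρ
  have hρ0 : 0 ≤ ρ := by linarith
  set k : ℕ := ⌈ρ / g⌉₊ with hk
  have hk1 : ρ ≤ k * g := by
    rw [← div_le_iff₀ hg.1]
    exact Nat.le_ceil _
  have hk2 : k * g < ρ + g := by
    have h := mul_lt_mul_of_pos_right (Nat.ceil_lt_add_one (div_nonneg hρ0 hg.1.le)) hg.1
    rwa [add_mul, one_mul, div_mul_cancel₀ _ hg.1.ne'] at h
  have hkK : k ≤ K := by
    refine Nat.ceil_le.2 (le_trans ?_ hK)
    exact div_le_div_of_nonneg_right (by linarith) hg.1.le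
  have hnonneg : ∀ z : ℤ, 0 ≤ (K : ℤ) * |z| + k * z := by
    intro z
    have h1 : (k : ℤ) * |z| ≤ K * |z| :=
      mul_le_mul_of_nonneg_right (by exact_mod_cast hkK) (abs_nonneg z)
    have h2 : -((k : ℤ) * |z|) ≤ k * z := by
      rw [← mul_neg]
      exact mul_le_mul_of_nonneg_left (neg_abs_le z) (by positivity)
    linarith
  obtain ⟨m, hm⟩ := Int.eq_ofNat_of_zero_le (add_nonneg (hnonneg m₀) (Int.natCast_nonneg q))
  obtain ⟨n, hn⟩ := Int.eq_ofNat_of_zero_le (hnonneg n₀)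
  have hm' : (m : ℝ) = K * |(m₀ : ℝ)| + k * m₀ + q := by
    have h : ((m : ℤ) : ℝ) = _ := congrArg _ hm.symm
    push_cast at h
    exact h
  have hn' : (n : ℝ) = K * |(n₀ : ℝ)| + k * n₀ := by
    have h : ((n : ℤ) : ℝ) = _ := congrArg _ hn.symm
    push_cast at h
    exact h
  have hsum : m * a + n * b = w + q * a + k * g := by
    rw [hm', hn', hw, ← hmn]
    ring
  exact ⟨m, n, by linarith, by linarith [hg.2]⟩

theorem IsTiling.isClosed_bdry {d : ℕ} {P : Set (Set (Space d))} (hP : IsTiling P) :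
    IsClosed (bdry P) := by
  rw [bdry, biUnion_eq_iUnion]
  refine LocallyFinite.isClosed_iUnion (fun x => ?_) fun _ => isClosed_frontier
  refine ⟨Metric.ball 0 (‖x‖ + 1), Metric.isOpen_ball.mem_nhds (by simp), ?_⟩
  refine ((hP.2 (‖x‖ + 1)).preimage Subtype.val_injective.injOn).subset ?_
  rintro ⟨T, hT⟩ ⟨y, hy, hyb⟩
  obtain ⟨z, hz, hzT⟩ := mem_closure_iff.1 (frontier_subset_closure hy) _ Metric.isOpen_ball hyb
  exact ⟨hT, z, hzT, hz⟩

namespace Scheme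

variable {d : ℕ} {σ : Scheme d}

/-! ### Paths in the substitution graph -/

theorem IsIrreducible.exists_descendant (hd : 0 < d) (h : σ.IsIrreducible) (i j : Fin σ.n) :
    ∃ b, σ.Descendant i b ∧ b.type = j := by
  obtain ⟨t, -, a, ha, rfl⟩ := h i j
  obtain ⟨b, hb, rfl⟩ := ((mem_flow_iff hd).1 ha).1.exists_descendant
  exact ⟨b, hb, rfl⟩

theorem IsReturnTime.exists_descendant (hd : 0 < d) {i : Fin σ.n} {t : ℝ}
    (h : σ.IsReturnTime i t) :
    ∃ b, σ.Descendant i b ∧ b.type = i ∧ -Real.log b.scale = t := by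
  obtain ⟨a, ha, hai, hvol⟩ := h
  obtain ⟨b, hb, rfl⟩ := ((mem_flow_iff hd).1 ha).1.exists_descendant
  refine ⟨b, hb, hai, ?_⟩
  have h1 : Real.exp t * b.scale = 1 :=
    (volume_toSet_eq_one_iff hd (mul_pos (Real.exp_pos t) hb.scale_pos)).1 hvol
  have h2 : b.scale = Real.exp (-t) := by
    rw [Real.exp_neg]
    exact eq_inv_of_mul_eq_one_right h1
  rw [h2, Real.log_exp, neg_neg]

theorem Descendant.exists_pow {i : Fin σ.n} {b : Label d σ.n} (hb : σ.Descendant i b)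
    (hi : b.type = i) (m : ℕ) :
    ∃ e, σ.Descendant i e ∧ e.type = i ∧ -Real.log e.scale = m * -Real.log b.scale := by
  induction m with
  | zero => exact ⟨_, .root, rfl, by simp⟩
  | succ m ih =>
    obtain ⟨e, he, hei, hlog⟩ := ih
    refine ⟨child e b, he.trans (hei ▸ hb), hi, ?_⟩
    change -Real.log (e.scale * b.scale) = _
    rw [Real.log_mul he.scale_pos.ne' hb.scale_pos.ne', neg_add, hlog]
    push_cast
    ring

theorem neg_log_scale_child {a b : Label d σ.n} (ha : 0 < a.scale) (hb : 0 < b.scale) :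
    -Real.log (child a b).scale = -Real.log a.scale + -Real.log b.scale := by
  change -Real.log (a.scale * b.scale) = _
  rw [Real.log_mul ha.ne' hb.ne', neg_add]

/-- Fixed paths lead from `j` to `i₁`, then to `i₂`, then to `k`; at `i₁` and `i₂` the return loops
may be repeated `m` and `n` times. The total length is a bounded overhead `len (j, k)` plus `m t₁ +
n t₂`. -/
theorem exists_descendant_log_mem_Ico (hd : 0 < d) (hirr : σ.IsIrreducible)
    (hinc : σ.IsIncommensurable) {δ : ℝ} (hδ : 0 < δ) :
    ∃ N : ℝ, ∀ x, N ≤ x → ∀ j k : Fin σ.n, ∃ b, σ.Descendant j b ∧ b.type = k ∧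
      x ≤ -Real.log b.scale ∧ -Real.log b.scale < x + δ := by
  obtain ⟨i₁, i₂, t₁, t₂, ht₁, ht₂, hr₁, hr₂, hq⟩ := hinc
  have hirr' : Irrational (t₁ / t₂) := by
    rintro ⟨q, hq'⟩
    exact hq ⟨q, by rw [hq', div_mul_cancel₀ _ ht₂.ne']⟩
  obtain ⟨N, hN⟩ := exists_nat_combination_mem_Ico ht₁ hirr' hδ
  obtain ⟨l₁, hl₁, hl₁i, rfl⟩ := hr₁.exists_descendant hd
  obtain ⟨l₂, hl₂, hl₂i, rfl⟩ := hr₂.exists_descendant hd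
  choose path hpath hpath_type using fun j k => hirr.exists_descendant hd j k
  set len : Fin σ.n × Fin σ.n → ℝ := fun p => -Real.log (path p.1 i₁).scale +
    -Real.log (path i₁ i₂).scale + -Real.log (path i₂ p.2).scale with hlen
  obtain ⟨C, hC⟩ := Finite.exists_le len
  refine ⟨N + C, fun x hx j k => ?_⟩
  have hCjk := hC (j, k)
  obtain ⟨m, n, h1, h2⟩ := hN (x - len (j, k)) (by linarith)
  obtain ⟨e₁, he₁, he₁i, hlog₁⟩ := hl₁.exists_pow hl₁i m
  obtain ⟨e₂, he₂, he₂i, hlog₂⟩ := hl₂.exists_pow hl₂i n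
  have hp₁ : σ.Descendant (path j i₁).type e₁ := by rwa [hpath_type]
  have hp₂ : σ.Descendant e₁.type (path i₁ i₂) := by rw [he₁i]; exact hpath _ _
  have hp₃ : σ.Descendant (path i₁ i₂).type e₂ := by rwa [hpath_type]
  have hp₄ : σ.Descendant e₂.type (path i₂ k) := by rw [he₂i]; exact hpath _ _
  have h34 := Descendant.trans hp₃ hp₄
  have h234 := Descendant.trans hp₂ h34
  have h1234 := Descendant.trans hp₁ h234
  refine ⟨_, (hpath j i₁).trans h1234, hpath_type i₂ k, ?_⟩
  rw [neg_log_scale_child (hpath j i₁).scale_pos h1234.scale_pos,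
    neg_log_scale_child hp₁.scale_pos h234.scale_pos,
    neg_log_scale_child hp₂.scale_pos h34.scale_pos,
    neg_log_scale_child hp₃.scale_pos hp₄.scale_pos, hlog₁, hlog₂]
  simp only [hlen] at h1 h2
  constructor <;> linarith

/-- Labelled tiles of large scale have descendants of any type and of roughly any given scale. -/
theorem exists_descendant_scale_mem_Ioc (hd : 0 < d) (hirr : σ.IsIrreducible)
    (hinc : σ.IsIncommensurable) (k : Fin σ.n) {y η : ℝ} (hy : 0 < y) (hη0 : 0 < η)
    (hη1 : η < 1) :
    ∃ L : ℝ, 0 < L ∧ ∀ c : Label d σ.n, L ≤ c.scale → ∃ b, σ.Descendant c.type b ∧ b.type = k ∧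
      η * y < c.scale * b.scale ∧ c.scale * b.scale ≤ y := by
  obtain ⟨N, hN⟩ := exists_descendant_log_mem_Ico hd hirr hinc
    (neg_pos.2 (Real.log_neg hη0 hη1))
  -- In logarithms, the descent needs a length in a window of width `-log η` starting at `log
  -- c.scale - log y`, which must be at least `N`.
  refine ⟨Real.exp (N + Real.log y), Real.exp_pos _, fun c hc => ?_⟩
  have hc0 : 0 < c.scale := (Real.exp_pos _).trans_le hc
  have hlog : N + Real.log y ≤ Real.log c.scale := (Real.le_log_iff_exp_le hc0).2 hc
  obtain ⟨b, hb, hbk, h1, h2⟩ := hN (Real.log c.scale - Real.log y) (by linarith) c.type k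
  have hb0 := hb.scale_pos
  refine ⟨b, hb, hbk, ?_, ?_⟩
  · rw [← Real.log_lt_log_iff (by positivity) (by positivity), Real.log_mul hη0.ne' hy.ne',
      Real.log_mul hc0.ne' hb0.ne']
    linarith
  · rw [← Real.log_le_log_iff (by positivity) (by positivity), Real.log_mul hc0.ne' hb0.ne']
    linarith

/-! ### Existence of substitution tilings -/

theorem toSet_subset_closure_interior {a : Label d σ.n} (ha : 0 < a.scale) :
    a.toSet σ.proto ⊆ closure (interior (a.toSet σ.proto)) := by
  rw [Label.interior_toSet ha.ne']
  rintro x hx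
  obtain ⟨y, hy, rfl⟩ := Label.mem_toSet.1 hx
  have h := σ.proto_subset_closure_interior _ hy
  have hcont : Continuous fun z : Space d => a.pos + a.scale • z := by fun_prop
  exact map_mem_closure (f := fun z : Space d => a.pos + a.scale • z) hcont h
    fun z hz => ⟨_, ⟨z, hz, rfl⟩, rfl⟩

theorem exists_descendant_small {i : Fin σ.n} {x : Space d} (hx : x ∈ σ.proto i) {s : ℝ}
    (hs : 0 < s) : ∃ b, σ.Descendant i b ∧ x ∈ b.toSet σ.proto ∧ b.scale < s := by
  obtain ⟨m, M, -, -, hM0, hM1, hmM⟩ := σ.exists_scale_bounds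
  have key : ∀ N : ℕ, ∃ b, σ.Descendant i b ∧ x ∈ b.toSet σ.proto ∧ b.scale ≤ M ^ N := by
    intro N
    induction N with
    | zero => exact ⟨_, .root, by simpa [Label.toSet] using hx, by simp⟩
    | succ N ih =>
      obtain ⟨b, hb, hxb, hbs⟩ := ih
      obtain ⟨e, he, hxe⟩ := exists_mem_toSet_child hxb
      refine ⟨child b e, .subst b e hb he, hxe, ?_⟩
      rw [pow_succ]
      exact mul_le_mul hbs (hmM _ e he).2 (σ.scale_pos _ e he).le (by positivity)
  obtain ⟨N, hN⟩ := exists_pow_lt_of_lt_one hs hM1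
  obtain ⟨b, hb, hxb, hbs⟩ := key N
  exact ⟨b, hb, hxb, hbs.trans_lt hN⟩

/-- A prototile contains, in an iterated substitution, a copy of itself around an interior fixed
point of the corresponding similarity. -/
theorem exists_descendant_fixed_point (hd : 0 < d) (hirr : σ.IsIrreducible) (i : Fin σ.n) :
    ∃ g, σ.Descendant i g ∧ g.type = i ∧ g.scale < 1 ∧
      ∃ p ∈ interior (σ.proto i), g.pos + g.scale • p = p := by
  obtain ⟨D, hD0, hD⟩ := σ.exists_proto_bound
  obtain ⟨x, hx⟩ := (σ.isTile i).interior_nonempty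
  obtain ⟨ρ, hρ, hball⟩ := Metric.isOpen_iff.1 isOpen_interior x hx
  -- A tile `b` around `x` of this scale has diameter below `ρ / 4`, so the similarity onto a copy
  -- `g` inside `b` moves `x` by less than `ρ / 4`. As its ratio is below 1/2, its fixed point is
  -- within `ρ / 2` of `x`.
  have hs : 0 < min (1 / 2) (ρ / (8 * D)) := by positivity
  obtain ⟨b, hb, hxb, hbs⟩ := exists_descendant_small (interior_subset hx) hs
  obtain ⟨e, he, hei⟩ := hirr.exists_descendant hd b.type i
  have hg := hb.trans he
  have he1 := he.scale_le_one
  have hgs : (child b e).scale ≤ b.scale := mul_le_of_le_one_right hb.scale_pos.le he1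
  have hg2 : (child b e).scale < 1 / 2 := hgs.trans_lt (hbs.trans_le (min_le_left _ _))
  have hbρ : b.scale * (2 * D) < ρ / 4 := by
    have h := hbs.trans_le (min_le_right _ _)
    rw [lt_div_iff₀ (by positivity)] at h
    linarith
  set g := child b e with hgdef
  have hgb : g.toSet σ.proto ⊆ b.toSet σ.proto := by
    have h : e.toSet σ.proto ⊆ (⟨b.type, 1, 0⟩ : Label d σ.n).toSet σ.proto := by
      simpa [Label.toSet] using he.toSet_subset
    have h' := Label.child_monotone (a := b) h
    rwa [Label.child_unit b rfl] at h'
  have hfx : g.pos + g.scale • x ∈ b.toSet σ.proto :=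
    hgb (Label.mem_toSet.2 ⟨x, by rw [show g.type = i from hei]; exact interior_subset hx, rfl⟩)
  have hdist : dist (g.pos + g.scale • x) x < ρ / 4 :=
    (Label.dist_le_of_mem_closure hD hb.scale_pos.le (subset_closure hfx)
      (subset_closure hxb)).trans_lt hbρ
  have h1 : (1 - g.scale) ≠ 0 := by linarith
  set p : Space d := (1 - g.scale)⁻¹ • g.pos with hp
  have hpos : g.pos = (1 - g.scale) • p := by rw [hp, smul_inv_smul₀ h1]
  have hfix : g.pos + g.scale • p = p := by rw [hpos, sub_smul, one_smul, sub_add_cancel]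
  refine ⟨g, hg, hei, by linarith, p, hball ?_, hfix⟩
  have h2 : dist p (g.pos + g.scale • x) = g.scale * dist p x := by
    conv_lhs => rw [← hfix]
    rw [dist_add_left, dist_smul₀, Real.norm_of_nonneg hg.scale_pos.le]
  have h3 := dist_triangle p (g.pos + g.scale • x) x
  have h4 : g.scale * dist p x ≤ 1 / 2 * dist p x :=
    mul_le_mul_of_nonneg_right hg2.le dist_nonneg
  rw [Metric.mem_ball]
  linarith

/-- If the supports of a nested sequence of patches `patch (c k)` exhaust the space, then the union
of these patches is a substitution tiling. -/
theorem isSubstitutionTiling_iUnion_patch (hd : 0 < d) {c : ℕ → Label d σ.n}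
    (hc : ∀ k, 1 ≤ (c k).scale) (hmono : Monotone fun k => σ.patch (c k))
    (hcover : ∀ r, ∃ k, Metric.ball 0 r ⊆ (c k).toSet σ.proto) :
    σ.IsSubstitutionTiling (⋃ k, σ.patch (c k)) := by
  have hc0 : ∀ k, 0 < (c k).scale := fun k => one_pos.trans_le (hc k)
  -- A further tile meeting the ball would overlap the support of `patch (c k)` in positive volume,
  -- although both belong to one tessellation, a later patch.
  have hfin : ∀ r k, Metric.ball 0 r ⊆ (c k).toSet σ.proto → ∀ T ∈ ⋃ k, σ.patch (c k),
      (T ∩ Metric.ball 0 r).Nonempty → T ∈ σ.patch (c k) := by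
    intro r k hk T hT hTr
    obtain ⟨l, hTl⟩ := mem_iUnion.1 hT
    by_contra hTk
    have htess := isTessellation_patch (hc0 (max k l))
    have h0 := htess.volume_interior_inter_sUnion (hmono (le_max_left k l))
      (σ.finite_patch _).countable (hmono (le_max_right k l) hTl) hTk
    rw [sUnion_patch] at h0
    obtain ⟨a, ⟨ha, -⟩, rfl⟩ := hTl
    obtain ⟨x, hx, hxr⟩ := hTr
    have hne := mem_closure_iff.1 (toSet_subset_closure_interior (ha.scale_pos (hc0 l)) hx) _
      Metric.isOpen_ball hxr
    have hpos := (Metric.isOpen_ball.inter isOpen_interior).measure_pos volume hne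
    refine hpos.ne' (measure_mono_null ?_ h0)
    exact fun y hy => ⟨hy.2, hk hy.1⟩
  have htile : ∀ T ∈ ⋃ k, σ.patch (c k), IsTile T := by
    intro T hT
    obtain ⟨k, hk⟩ := mem_iUnion.1 hT
    exact (isTessellation_patch (hc0 k)).1 T hk
  refine ⟨⟨⟨htile, ?_, ?_⟩, fun r => ?_⟩, fun Q hQ hb => ?_⟩
  · intro S hS T hT hne
    obtain ⟨k, hk⟩ := mem_iUnion.1 hS
    obtain ⟨l, hl⟩ := mem_iUnion.1 hT
    exact pairwise_patch (hc0 (max k l)) (hmono (le_max_left k l) hk)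
      (hmono (le_max_right k l) hl) hne
  · refine eq_univ_of_forall fun x => ?_
    obtain ⟨k, hk⟩ := hcover (‖x‖ + 1)
    have hx := hk (by simp : x ∈ Metric.ball 0 (‖x‖ + 1))
    rw [← sUnion_patch] at hx
    exact sUnion_subset_sUnion (subset_iUnion _ k) hx
  · obtain ⟨k, hk⟩ := hcover r
    exact (σ.finite_patch (c k)).subset fun T hT => hfin r k hk T hT.1 hT.2
  · obtain ⟨r, hr⟩ := hb.subset_ball 0
    obtain ⟨k, hk⟩ := hcover r
    have hQk : Q ⊆ σ.patch (c k) := by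
      intro T hT
      refine hfin r k hk T (hQ hT) ?_
      obtain ⟨x, hx⟩ := (htile T (hQ hT)).interior_nonempty
      exact ⟨x, interior_subset hx, hr ⟨T, hT, interior_subset hx⟩⟩
    -- `Q` is itself a translated sub-patch of a generating patch, so a constant sequence suffices.
    refine ⟨fun _ => translate (-(c k).pos) Q, fun _ => (c k).pos, fun _ => ?_, ?_, ?_⟩
    · refine ⟨_, ⟨(c k).type, Real.log (c k).scale, Real.log_nonneg (hc k), rfl⟩, ?_⟩
      rw [flowPatch_eq hd, Real.exp_log (hc0 k)]
      have h := translate_mono hQk (-(c k).pos)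
      rwa [translate_patch, neg_add_cancel] at h
    · simp only [← translate_add, add_neg_cancel, translate_zero, cfDist_self]
      exact tendsto_const_nhds
    · simp only [← translate_add, add_neg_cancel, translate_zero, symmDiff_self, bot_eq_empty,
        measure_empty]
      exact tendsto_const_nhds

theorem nonempty_tilingSpace (hd : 0 < d) (hirr : σ.IsIrreducible) (i : Fin σ.n) :
    Nonempty σ.tilingSpace := by
  obtain ⟨m, M, -, -, hM0, hM1, hmM⟩ := σ.exists_scale_bounds
  obtain ⟨g, hg, hgi, hg1, p, hp, hfix⟩ := exists_descendant_fixed_point hd hirr i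
  have hg0 := hg.scale_pos
  set A : ℕ → ℝ := fun k => (g.scale ^ k)⁻¹ with hA
  have hA0 : ∀ k, 0 < A k := fun k => inv_pos.2 (pow_pos hg0 k)
  have hA1 : ∀ k, 1 ≤ A k := fun k =>
    (one_le_inv₀ (pow_pos hg0 k)).2 (pow_le_one₀ hg0.le hg1.le)
  have hAsucc : ∀ k, A (k + 1) * g.scale = A k := by
    intro k
    simp only [hA, pow_succ]
    field_simp
  -- `c k` is the prototile expanded by `A k` about `p`. Since `g` fixes `p`, its copy inside `c (k
  -- + 1)` is exactly `c k`.
  set c : ℕ → Label d σ.n := fun k => ⟨i, A k, (1 - A k) • p⟩ with hc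
  have hpos : g.pos = p - g.scale • p := eq_sub_of_add_eq hfix
  have hchild : ∀ k, child (c (k + 1)) g = c k := by
    intro k
    simp only [child, hc, hgi, hAsucc, hpos]
    congr 1
    rw [smul_sub, smul_smul, hAsucc, sub_smul, sub_smul, one_smul]
    abel
  have hmono : Monotone fun k => σ.patch (c k) := by
    refine monotone_nat_of_le_succ fun k => patch_mono ?_
    have h := hg.occursIn hM0 (fun i a ha => (hmM i a ha).2) (c := c (k + 1)) rfl
      (hA0 _) ?_
    · rwa [hchild] at h
    · change M < A (k + 1) * g.scale
      rw [hAsucc]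
      exact hM1.trans_le (hA1 k)
  have hcover : ∀ r, ∃ k, Metric.ball 0 r ⊆ (c k).toSet σ.proto := by
    intro r
    obtain ⟨ρ, hρ, hball⟩ := Metric.isOpen_iff.1 isOpen_interior p hp
    have hpos' : 0 < |r| + ‖p‖ + 1 := by positivity
    obtain ⟨k, hk⟩ := exists_pow_lt_of_lt_one (div_pos hρ hpos') hg1
    rw [lt_div_iff₀ hpos'] at hk
    refine ⟨k, fun x hx => Label.mem_toSet.2 ⟨p + g.scale ^ k • (x - p), ?_, ?_⟩⟩
    · refine interior_subset (hball ?_)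
      rw [Metric.mem_ball, dist_eq_norm, add_sub_cancel_left, norm_smul,
        Real.norm_of_nonneg (pow_nonneg hg0.le k)]
      refine lt_of_le_of_lt (mul_le_mul_of_nonneg_left ?_ (pow_nonneg hg0.le k)) hk
      have h1 := norm_sub_le x p
      have h2 := mem_ball_zero_iff.1 hx
      linarith [le_abs_self r]
    · simp only [hc, hA, smul_add, smul_smul, inv_mul_cancel₀ (pow_ne_zero k hg0.ne'), one_smul,
        sub_smul]
      abel
  have htil := isSubstitutionTiling_iUnion_patch hd hA1 hmono hcover
  exact ⟨⟨⟨_, htil.1.isClosed_bdry⟩, _, htil, rfl⟩⟩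

end Scheme

theorem IsTile.exists_mem_of_mem_frontier {d : ℕ} {T U : Set (Space d)} (hU : IsOpen U)
    {x : Space d} (hx : x ∈ frontier T) (hxU : x ∈ U) : (T ∩ U).Nonempty := by
  obtain ⟨y, hy, hyT⟩ := mem_closure_iff.1 (frontier_subset_closure hx) U hU hxU
  exact ⟨y, hyT, hy⟩

theorem exists_mem_inter_of_volume_diff_lt {d : ℕ} {A S : Set (Space d)}
    (h : volume (A \ S) < volume A) : (A ∩ S).Nonempty := by
  by_contra hne
  rw [not_nonempty_iff_eq_empty, ← disjoint_iff_inter_eq_empty] at hne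
  rw [hne.sdiff_eq_left] at h
  exact h.false

namespace Scheme

variable {d : ℕ} {σ : Scheme d}

/-! ### Approximation of substitution tilings by generating patches -/

/-- The tiles of `P` that meet the ball form a bounded sub-patch, hence a limit of legal patches. It
covers the ball and carries all of `bdry P` inside it. -/
theorem IsSubstitutionTiling.exists_approx {P : Set (Set (Space d))}
    (hd : 0 < d) (hP : σ.IsSubstitutionTiling P) (r : ℝ) {e : ℝ} (he : 0 < e) {κ : ENNReal}
    (hκ : 0 < κ) :
    ∃ (c : Label d σ.n) (R : Set (Set (Space d))), 1 ≤ c.scale ∧ R ⊆ σ.patch c ∧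
      bdry P ∩ Metric.ball 0 r ⊆ Metric.thickening e (bdry R) ∧
      bdry R ∩ Metric.ball 0 r ⊆ Metric.thickening e (bdry P) ∧
      volume (Metric.ball 0 r \ ⋃₀ R) < κ := by
  obtain ⟨⟨⟨htile, -, hcover⟩, hfin⟩, hlim⟩ := hP
  set Q : Set (Set (Space d)) := {T ∈ P | (T ∩ Metric.ball 0 r).Nonempty} with hQ
  have hQP : Q ⊆ P := fun T h => h.1
  have hbd : Bornology.IsBounded (⋃₀ Q) :=
    (Bornology.isBounded_sUnion (hfin r)).2 fun T hT => (htile T hT.1).1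
  obtain ⟨R, v, hR, hdist, hvol⟩ := hlim Q hQP hbd
  -- The three terms give precision `e`, validity on the whole ball of radius `r`, and the bound
  -- required by `exists_radius`.
  have he' : 0 < min (min e (1 / (|r| + 1))) 1 := by positivity
  obtain ⟨k, hk, hkv⟩ := ((hdist.eventually_lt_const he').and
    (hvol.eventually_lt_const hκ)).exists
  obtain ⟨s, hs, hse⟩ := exists_radius hk (min_le_right _ _)
  obtain ⟨_, ⟨i, t, ht, rfl⟩, hRP⟩ := hR k
  have hs0 := hs.1
  have hle : s ≤ e := (hse.trans_le ((min_le_left _ _).trans (min_le_left _ _))).le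
  have hrs : r ≤ 1 / s := by
    have h1 : s ≤ 1 / (|r| + 1) :=
      (hse.trans_le ((min_le_left _ _).trans (min_le_right _ _))).le
    have h2 := (le_one_div hs0 (by positivity)).1 h1
    linarith [le_abs_self r]
  have hball : Metric.ball (0 : Space d) r ⊆ Metric.ball 0 (1 / s) := Metric.ball_subset_ball hrs
  refine ⟨⟨i, Real.exp t, v k⟩, translate (v k) (R k), Real.one_le_exp ht, ?_, ?_, ?_, ?_⟩
  · refine (translate_mono hRP _).trans ?_
    rw [flowPatch_eq hd, translate_patch, add_zero]
  · rintro x ⟨hx, hxr⟩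
    obtain ⟨T, hT, hxT⟩ := mem_bdry.1 hx
    have hTQ : T ∈ Q := ⟨hT, IsTile.exists_mem_of_mem_frontier Metric.isOpen_ball hxT hxr⟩
    exact Metric.thickening_mono hle _ (hs.2.2 ⟨mem_bdry.2 ⟨T, hTQ, hxT⟩, hball hxr⟩)
  · rintro x ⟨hx, hxr⟩
    exact Metric.thickening_mono hle _
      (Metric.thickening_subset_of_subset s (bdry_mono hQP) (hs.2.1 ⟨hx, hball hxr⟩))
  · refine (measure_mono ?_).trans_lt hkv
    rintro x ⟨hx, hxR⟩
    have hxP : x ∈ ⋃₀ P := by rw [hcover]; trivial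
    obtain ⟨T, hT, hxT⟩ := hxP
    exact Or.inr ⟨⟨T, ⟨hT, x, hxT, hx⟩, hxT⟩, hxR⟩

/-- Every patch has a copy, scaled by a factor slightly below `1`, in all large patches. -/
theorem exists_scaled_copy (hd : 0 < d) (hirr : σ.IsIrreducible) (hinc : σ.IsIncommensurable)
    {c : Label d σ.n} (hc : 1 ≤ c.scale) {η₀ : ℝ} (hη₀ : η₀ < 1) :
    ∃ L : ℝ, 0 < L ∧ ∀ a : Label d σ.n, L ≤ a.scale → ∃ (η : ℝ) (u : Space d),
      η₀ < η ∧ η ≤ 1 ∧ ∀ T ∈ σ.patch c, u +ᵥ η • T ∈ σ.patch a := by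
  obtain ⟨m, M, -, -, hM0, hM1, hmM⟩ := σ.exists_scale_bounds
  have hev : ∀ᶠ η in 𝓝 (1 : ℝ), ∀ b ∈ {b | σ.OccursIn c b}, ∀ g : Label d σ.n,
      g.scale = η → σ.OccursIn (child g c) (child g b) :=
    (eventually_all_finite (σ.finite_occursIn c)).2 fun b hb => hb.eventually_child
  obtain ⟨δ, hδ, hball⟩ := Metric.eventually_nhds_iff.1 hev
  -- Exceeding `M` makes the descendant occur in the substitution of `a`; exceeding `1 - δ`
  -- preserves every cut of `c`.
  set η₁ : ℝ := max (max η₀ M) (1 - δ) with hη₁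
  have hη₁0 : 0 < η₁ := hM0.trans_le ((le_max_right _ _).trans (le_max_left _ _))
  have hη₁1 : η₁ < 1 := max_lt (max_lt hη₀ hM1) (by linarith)
  have hc0 : 0 < c.scale := by linarith
  obtain ⟨L, hL0, hL⟩ := exists_descendant_scale_mem_Ioc hd hirr hinc c.type hc0 hη₁0 hη₁1
  refine ⟨L, hL0, fun a ha => ?_⟩
  have ha0 : 0 < a.scale := hL0.trans_le ha
  obtain ⟨b, hb, hbc, h1, h2⟩ := hL a ha
  have hMb : M < a.scale * b.scale := by
    refine lt_of_le_of_lt ?_ h1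
    calc M ≤ η₁ := (le_max_right _ _).trans (le_max_left _ _)
      _ ≤ η₁ * c.scale := le_mul_of_one_le_right hη₁0.le hc
  have hocc := hb.occursIn hM0 (fun i a ha => (hmM i a ha).2) rfl ha0 hMb
  set η : ℝ := a.scale * b.scale / c.scale with hη
  have hη_gt : η₁ < η := by rwa [hη, lt_div_iff₀ hc0]
  have hη_le : η ≤ 1 := by rwa [hη, div_le_one hc0]
  have hηδ : dist η 1 < δ := by
    rw [Real.dist_eq, abs_sub_comm, abs_of_nonneg (by linarith)]
    linarith [(le_max_right _ _ : 1 - δ ≤ η₁)]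
  -- The similarity of ratio `η` that carries `c` to the descendant of `a`.
  set g : Label d σ.n := ⟨c.type, η, (child a b).pos - η • c.pos⟩ with hg
  have hgc : child g c = child a b := by
    simp only [child, hg, hbc, sub_add_cancel, hη, div_mul_cancel₀ _ hc0.ne']
  refine ⟨η, g.pos, ((le_max_left _ _).trans (le_max_left _ _)).trans_lt hη_gt, hη_le, ?_⟩
  rintro _ ⟨e, ⟨he, he1⟩, rfl⟩
  refine patch_mono hocc ⟨child g e, ⟨?_, ?_⟩, Label.toSet_child g e⟩
  · rw [← hgc]
    exact hball hηδ e he g rfl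
  · exact mul_le_one₀ hη_le (he.scale_pos hc0).le he1

/-- A patch that covers most of a large ball comes from a tile of large scale. -/
theorem lt_scale_of_volume_diff_lt (hd : 0 < d) {D : ℝ} (hD0 : 0 < D)
    (hD : ∀ i, σ.proto i ⊆ Metric.closedBall 0 D) {c : Label d σ.n} (hc : 0 < c.scale) {s r : ℝ}
    {R : Set (Set (Space d))} (hR : R ⊆ σ.patch c) (hr : s * (2 * D) + 3 ≤ r) (hs : 0 ≤ s)
    (hvol : volume (Metric.ball 0 r \ ⋃₀ R) < volume (Metric.ball (0 : Space d) 1)) :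
    s < c.scale := by
  by_contra hcon
  push Not at hcon
  have hsD : 0 ≤ s * (2 * D) := by positivity
  have hRc : ⋃₀ R ⊆ c.toSet σ.proto := by
    rw [← sUnion_patch]
    exact sUnion_subset_sUnion hR
  have h1 : volume (Metric.ball 0 1 \ ⋃₀ R) < volume (Metric.ball (0 : Space d) 1) :=
    (measure_mono (sdiff_subset_sdiff_left (Metric.ball_subset_ball (by linarith)))).trans_lt hvol
  obtain ⟨x, hx, hxR⟩ := exists_mem_inter_of_volume_diff_lt h1
  -- `R` reaches the unit ball at the origin and has diameter at most `s * (2 * D)`, so it misses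
  -- the unit ball around `u`, which then is uncovered.
  set u : Space d := (s * (2 * D) + 2) • EuclideanSpace.single ⟨0, hd⟩ 1 with hu
  have hunorm : ‖u‖ = s * (2 * D) + 2 := by
    rw [hu, norm_smul, PiLp.norm_single, norm_one, mul_one,
      Real.norm_of_nonneg (by linarith)]
  have hsub : Metric.ball u 1 ⊆ Metric.ball 0 r \ ⋃₀ R := by
    intro y hy
    rw [Metric.mem_ball] at hy
    have hx' := mem_ball_zero_iff.1 hx
    refine ⟨?_, fun hyR => ?_⟩
    · rw [Metric.mem_ball]
      have := dist_triangle y u 0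
      rw [dist_zero_right u] at this
      linarith
    · have h2 := Label.dist_le_of_mem_closure hD hc.le (subset_closure (hRc hyR))
        (subset_closure (hRc hxR))
      have h3 : c.scale * (2 * D) ≤ s * (2 * D) := by gcongr
      have h4 := dist_triangle4 u y x 0
      rw [dist_zero_right, dist_zero_right, dist_comm u y] at h4
      linarith
  have h2 := (measure_mono hsub).trans_lt hvol
  rw [Measure.addHaar_ball_center] at h2
  exact h2.false

/-! ### Minimality -/

theorem exists_cfDist_vadd_lt (hd : 0 < d) (hirr : σ.IsIrreducible) (hinc : σ.IsIncommensurable)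
    {P Q : Set (Set (Space d))} (hP : σ.IsSubstitutionTiling P) (hQ : σ.IsSubstitutionTiling Q)
    {ε : ℝ} (hε : 0 < ε) : ∃ w : Space d, cfDist (w +ᵥ bdry P) (bdry Q) < ε := by
  obtain ⟨m, M, hm0, hm1, hM0, hM1, hmM⟩ := σ.exists_scale_bounds
  have hm : ∀ i, ∀ a ∈ σ.rule i, m ≤ a.scale := fun i a ha => (hmM i a ha).1
  obtain ⟨D, hD0, hD⟩ := σ.exists_proto_bound
  set s : ℝ := min (ε / 2) 1 with hs
  have hs0 : 0 < s := by positivity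
  have hsε : s < ε := (min_le_left _ _).trans_lt (by linarith)
  have hs1 : s ≤ 1 := min_le_right _ _
  set r : ℝ := 1 / s with hr
  have hr0 : 0 < r := by positivity
  set e : ℝ := s / 4 with he
  have he0 : 0 < e := by positivity
  obtain ⟨κ, hκ0, hκ⟩ := σ.exists_volume_ball_inter_interior hm0 he0
  have hB0 : 0 < volume (Metric.ball (0 : Space d) 1) := Metric.measure_ball_pos _ _ one_pos
  -- Points within `r + 1 + e` of the centre of the copy are pulled back by a ratio `η > 1 / 2` into
  -- this radius.
  set r₁ : ℝ := 2 * (r + 2) with hr₁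
  obtain ⟨q, S, hq1, hSq, hQS, hSQ, hSvol⟩ := hQ.exists_approx hd r₁ he0 (lt_min hκ0 hB0)
  -- The second term makes shrinking by `η` move points of the `r₁`-ball by at most `e`.
  have hη₀ : max (1 / 2) (1 - e / r₁) < 1 :=
    max_lt (by norm_num) (sub_lt_self _ (by positivity))
  obtain ⟨L, hL0, hL⟩ := exists_scaled_copy hd hirr hinc hq1 hη₀
  -- An ancestor of scale in `[m * l, l]` is large enough to contain a copy of `S`, yet has bounded
  -- diameter.
  set l : ℝ := max 1 (L / m) with hl
  have hl1 : 1 ≤ l := le_max_left _ _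
  have hLl : L ≤ m * l := by
    rw [← div_le_iff₀' hm0]
    exact le_max_right _ _
  have hlD : 0 < l * (2 * D) := by positivity
  -- Large enough to contain the ancestor `a` and the ball of radius `r + 1` around the centre `u`
  -- of the copy.
  set r₂ : ℝ := l * (2 * D) + r + 10 with hr₂
  have hmd : 0 < ENNReal.ofReal (m ^ d) := by simpa using pow_pos hm0 d
  obtain ⟨c, R, hc1, hRc, hPR, hRP, hRvol⟩ := hP.exists_approx hd r₂ he0 (lt_min hmd hB0)
  have hc0 : 0 < c.scale := by linarith
  have hlc : l < c.scale := lt_scale_of_volume_diff_lt hd hD0 hD hc0 hRc (by linarith)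
    (by linarith) (hRvol.trans_le (min_le_right _ _))
  have htess := isTessellation_patch hc0
  -- a tile of `R` near the origin, and an ancestor of it
  obtain ⟨x₀, hx₀, _, hTR, hx₀T⟩ := exists_mem_inter_of_volume_diff_lt (A := Metric.ball 0 1)
    (S := ⋃₀ R) ((measure_mono (sdiff_subset_sdiff_left
      (Metric.ball_subset_ball (by linarith)))).trans_lt (hRvol.trans_le (min_le_right _ _)))
  obtain ⟨b, ⟨hcb, hb1⟩, rfl⟩ := hRc hTR
  obtain ⟨a, hca, hma, hal, hab⟩ := hcb.exists_ancestor hm0.le hm (hb1.trans hl1) hlc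
  have ha_ball : ∀ y ∈ a.toSet σ.proto, ‖y‖ < l * (2 * D) + 1 := by
    intro y hy
    have h1 := Label.dist_le_of_mem_closure hD (hca.scale_pos hc0).le (subset_closure hy)
      (subset_closure (hab.toSet_subset hx₀T))
    have h2 : a.scale * (2 * D) ≤ l * (2 * D) := by gcongr
    have h3 := mem_ball_zero_iff.1 hx₀
    have h4 := dist_triangle y x₀ 0
    rw [dist_zero_right, dist_zero_right] at h4
    linarith
  obtain ⟨η, u, hη, hη1, hcopy⟩ := hL a (hLl.trans hma)
  have hη2 : 1 / 2 < η := (le_max_left _ _).trans_lt hη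
  have hη0 : 0 < η := by linarith
  have hηe : (1 - η) * r₁ ≤ e := by
    have h1 := (le_max_right _ _).trans_lt hη
    rw [← le_div_iff₀ (by positivity)]
    linarith
  have hcopy_sub : ∀ T ∈ S, u +ᵥ η • T ⊆ a.toSet σ.proto := by
    intro T hT
    rw [← sUnion_patch]
    exact subset_sUnion_of_mem (hcopy T (hSq hT))
  -- the scaled copy of `S` is contained in `R`
  have hcopyR : ∀ T ∈ S, u +ᵥ η • T ∈ R := by
    intro T hT
    -- A missing tile meets the support of `R` in a null set up to its boundary, so its volume, at
    -- least `m ^ d`, would be uncovered.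
    by_contra hTR'
    have hTc := patch_mono hca (hcopy T (hSq hT))
    have h0 := htess.volume_interior_inter_sUnion hRc
      ((σ.finite_patch c).subset hRc).countable hTc hTR'
    obtain ⟨f, ⟨hf, -⟩, hfT⟩ := hTc
    have hfm : m ≤ f.scale := hf.le_scale hm1.le hm hc1
    have hf0 := hf.scale_pos hc0
    have hsub : interior (u +ᵥ η • T) ⊆
        (Metric.ball 0 r₂ \ ⋃₀ R) ∪ (interior (u +ᵥ η • T) ∩ ⋃₀ R) := by
      intro y hy
      by_cases hyR : y ∈ ⋃₀ R
      · exact Or.inr ⟨hy, hyR⟩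
      · refine Or.inl ⟨?_, hyR⟩
        have := ha_ball y (hcopy_sub T hT (interior_subset hy))
        rw [mem_ball_zero_iff]
        linarith
    have h1 : volume (interior (u +ᵥ η • T)) ≤ volume (Metric.ball 0 r₂ \ ⋃₀ R) := by
      refine (measure_mono hsub).trans ((measure_union_le _ _).trans ?_)
      rw [h0, add_zero]
    rw [← hfT, (isTile_toSet hf0).volume_interior, volume_toSet hf0] at h1
    have h2 := h1.trans_lt (hRvol.trans_le (min_le_left _ _))
    exact h2.not_ge (ENNReal.ofReal_le_ofReal (pow_le_pow_left₀ hm0.le hfm d))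
  have hu : ‖u‖ < l * (2 * D) + 2 := by
    obtain ⟨z, hz, T, hT, hzT⟩ := exists_mem_inter_of_volume_diff_lt (A := Metric.ball 0 1)
      (S := ⋃₀ S) ((measure_mono (sdiff_subset_sdiff_left
        (Metric.ball_subset_ball (by linarith)))).trans_lt (hSvol.trans_le (min_le_right _ _)))
    have h1 := ha_ball (u + η • z) (hcopy_sub T hT ⟨_, ⟨z, hzT, rfl⟩, rfl⟩)
    have h2 : ‖η • z‖ ≤ 1 := by
      rw [norm_smul, Real.norm_of_nonneg hη0.le]
      exact mul_le_one₀ hη1 (norm_nonneg _) (mem_ball_zero_iff.1 hz).le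
    have h3 := norm_sub_le (u + η • z) (η • z)
    rw [add_sub_cancel_right] at h3
    linarith
  -- near `u`, there are no other tiles of `R`
  have hnear : ∀ T' ∈ R, ∀ x ∈ frontier T', ‖x - u‖ < r + 1 → ∃ T ∈ S, u +ᵥ η • T = T' := by
    intro T' hT' x hx hxu
    -- Another tile would occupy volume at least `κ` near `x`, disjoint from the copy up to a null
    -- set, but the part of the scaled ball that the copy misses has volume less than `κ`.
    by_contra hcon
    have hTG : T' ∉ (fun T => u +ᵥ η • T) '' S := fun ⟨T, hT, h⟩ => hcon ⟨T, hT, h⟩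
    have hGc : (fun T => u +ᵥ η • T) '' S ⊆ σ.patch c := by
      rintro _ ⟨T, hT, rfl⟩
      exact hRc (hcopyR T hT)
    have h0 := htess.volume_interior_inter_sUnion hGc
      ((σ.finite_patch c).subset hGc).countable (hRc hT') hTG
    obtain ⟨f, ⟨hf, hf1⟩, rfl⟩ := hRc hT'
    have hfm : m ≤ f.scale := hf.le_scale hm1.le hm hc1
    have hκx := hκ f hfm hf1 x (frontier_subset_closure hx)
    have hsub : Metric.ball x e ∩ interior (f.toSet σ.proto) ⊆
        (u +ᵥ η • (Metric.ball 0 r₁ \ ⋃₀ S)) ∪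
          (interior (f.toSet σ.proto) ∩ ⋃₀ ((fun T => u +ᵥ η • T) '' S)) := by
      rintro y ⟨hyx, hyf⟩
      have hy : u +ᵥ η • (η⁻¹ • (y - u)) = y := by
        rw [smul_inv_smul₀ hη0.ne', vadd_eq_add, add_sub_cancel]
      by_cases hyS : η⁻¹ • (y - u) ∈ ⋃₀ S
      · obtain ⟨T, hT, hyT⟩ := hyS
        exact Or.inr ⟨hyf, _, ⟨T, hT, rfl⟩, _, ⟨_, hyT, rfl⟩, hy⟩
      · refine Or.inl ⟨_, ⟨_, ⟨?_, hyS⟩, rfl⟩, hy⟩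
        rw [mem_ball_zero_iff, norm_smul, norm_inv, Real.norm_of_nonneg hη0.le,
          inv_mul_lt_iff₀ hη0]
        have h1 : ‖y - u‖ ≤ ‖y - x‖ + ‖x - u‖ := norm_sub_le_norm_sub_add_norm_sub _ _ _
        rw [Metric.mem_ball, dist_eq_norm] at hyx
        nlinarith
    have h1 : volume (u +ᵥ η • (Metric.ball 0 r₁ \ ⋃₀ S)) ≤
        volume (Metric.ball 0 r₁ \ ⋃₀ S) := by
      rw [measure_vadd, Measure.addHaar_smul, abs_of_nonneg (by positivity)]
      refine mul_le_of_le_one_left' ?_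
      rw [ENNReal.ofReal_le_one]
      exact pow_le_one₀ hη0.le hη1
    have h2 : κ ≤ volume (Metric.ball 0 r₁ \ ⋃₀ S) := by
      refine hκx.trans ((measure_mono hsub).trans ((measure_union_le _ _).trans ?_))
      rwa [h0, add_zero]
    exact (hSvol.trans_le (min_le_left _ _)).not_ge h2
  have hscale : ∀ z : Space d, ‖z‖ < r₁ → dist (η • z) z ≤ e := by
    intro z hz
    rw [dist_comm, dist_eq_norm]
    have h1 : z - η • z = (1 - η) • z := by rw [sub_smul, one_smul]
    rw [h1, norm_smul, Real.norm_of_nonneg (by linarith)]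
    exact (mul_le_mul_of_nonneg_left hz.le (by linarith)).trans hηe
  have hfront : ∀ T : Set (Space d), frontier (u +ᵥ η • T) = u +ᵥ η • frontier T := by
    intro T
    rw [frontier_vadd_set, frontier_smul_set hη0.ne']
  -- In both directions three errors of at most `e = s / 4` add up: between `P` and `R`, from
  -- undoing the shrinking by `η`, and between `S` and `Q`.
  refine ⟨-u, (cfDist_le ⟨hs0, ?_, ?_⟩).trans_lt hsε⟩
  · rintro _ ⟨⟨x, hx, rfl⟩, hxr⟩
    simp only [vadd_eq_add, mem_ball_zero_iff] at hxr
    have hx2 : x ∈ Metric.ball (0 : Space d) r₂ := by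
      have h1 := norm_add_le u (-u + x)
      rw [add_neg_cancel_left] at h1
      rw [mem_ball_zero_iff]
      linarith
    obtain ⟨y, hy, hxy⟩ := Metric.mem_thickening_iff.1 (hPR ⟨hx, hx2⟩)
    obtain ⟨T', hT', hyT'⟩ := mem_bdry.1 hy
    have hyu : ‖y - u‖ < r + 1 := by
      have h1 : ‖y - u‖ ≤ ‖y - x‖ + ‖x - u‖ := norm_sub_le_norm_sub_add_norm_sub _ _ _
      rw [← dist_eq_norm y x, dist_comm] at h1
      rw [neg_add_eq_sub] at hxr
      linarith
    obtain ⟨T, hT, rfl⟩ := hnear T' hT' y hyT' hyu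
    rw [hfront] at hyT'
    obtain ⟨_, ⟨z, hz, rfl⟩, rfl⟩ := hyT'
    simp only [vadd_eq_add, add_sub_cancel_left] at hyu hxy
    have hz1 : ‖z‖ < r₁ := by
      rw [norm_smul, Real.norm_of_nonneg hη0.le] at hyu
      nlinarith [norm_nonneg z]
    obtain ⟨y, hyQ, hzy⟩ := Metric.mem_thickening_iff.1
      (hSQ ⟨mem_bdry.2 ⟨T, hT, hz⟩, mem_ball_zero_iff.2 hz1⟩)
    refine Metric.mem_thickening_iff.2 ⟨y, hyQ, ?_⟩
    have h1 : dist (-u + x) (η • z) < e := by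
      rwa [← dist_add_left u, add_neg_cancel_left]
    have h2 := dist_triangle4 (-u + x) (η • z) z y
    simp only [vadd_eq_add]
    linarith [hscale z hz1]
  · rintro y ⟨hy, hyr⟩
    rw [mem_ball_zero_iff] at hyr
    obtain ⟨z, hz, hyz⟩ := Metric.mem_thickening_iff.1
      (hQS ⟨hy, mem_ball_zero_iff.2 (by linarith)⟩)
    obtain ⟨T, hT, hzT⟩ := mem_bdry.1 hz
    have hz1 : ‖z‖ < r + 1 := by
      have h1 := dist_triangle z y 0
      rw [dist_zero_right, dist_zero_right, dist_comm z y] at h1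
      linarith
    have hzR : u + η • z ∈ bdry R := by
      refine mem_bdry.2 ⟨_, hcopyR T hT, ?_⟩
      rw [hfront]
      exact ⟨_, ⟨z, hzT, rfl⟩, rfl⟩
    have hzr : u + η • z ∈ Metric.ball (0 : Space d) r₂ := by
      rw [mem_ball_zero_iff]
      have h1 := norm_add_le u (η • z)
      have h2 : ‖η • z‖ ≤ ‖z‖ := by
        rw [norm_smul, Real.norm_of_nonneg hη0.le]
        exact mul_le_of_le_one_left (norm_nonneg _) hη1
      linarith
    obtain ⟨x, hx, hzx⟩ := Metric.mem_thickening_iff.1 (hRP ⟨hzR, hzr⟩)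
    refine Metric.mem_thickening_iff.2 ⟨-u + x, ⟨x, hx, rfl⟩, ?_⟩
    have h1 : dist (η • z) (-u + x) < e := by
      rwa [← dist_add_left u, add_neg_cancel_left]
    have h2 := dist_triangle4 y z (η • z) (-u + x)
    have h3 := hscale z (by linarith)
    rw [dist_comm] at h3
    linarith

end Scheme

end MultiscaleTiling

theorem mainTheorem2 (d : ℕ) (hd : 0 < d) (σ : MultiscaleTiling.Scheme d)
    (hirr : σ.IsIrreducible) (hinc : σ.IsIncommensurable) :
    Nonempty σ.tilingSpace ∧ AddAction.IsMinimal (MultiscaleTiling.Space d) σ.tilingSpace := by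
  refine ⟨?_, ⟨fun A => Metric.dense_iff.2 fun B ε hε => ?_⟩⟩
  -- Incommensurability guarantees that there is a prototile.
  · obtain ⟨i, -⟩ := hinc
    exact MultiscaleTiling.Scheme.nonempty_tilingSpace hd hirr i
  · obtain ⟨P, hP, hA⟩ := A.2
    obtain ⟨Q, hQ, hB⟩ := B.2
    obtain ⟨w, hw⟩ :=
      MultiscaleTiling.Scheme.exists_cfDist_vadd_lt hd hirr hinc hP hQ hε
    refine ⟨w +ᵥ A, ?_, w, rfl⟩
    change MultiscaleTiling.cfDist (w +ᵥ A.1.carrier) B.1.carrier < ε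
    rwa [hA, hB]
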